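/- Let $m,n\ge 1$ be integers and let $A=\{(p,q)\in\mathbb{Z}^2: 0\le p<m,\ 0\le q<n\}$. Let $D$ be a finite nonempty set of $d$ primitive lattice directions, i.e. pairs $(a,b)$ of coprime integers, where $(a,b)$ and $(-a,-b)$ are identified; we take representatives with $a>0$, or $(a,b)=(0,1)$. Let $V$ be an abelian group; for example $V=\mathbb{R}$, $V=\mathbb{Z}$, or the additive group of any field or any unique factorization domain. For $f:A\to V$, $(a,b)\in D$ and $c\in\mathbb{Z}$ the line sum of $f$ along the line $aq=bp+c$ is $\ell(a,b,c,f)=\sum_{(p,q)\in A,\ aq=bp+c} f(p,q)$. A switching function of $(A,D)$ is a function $F:A\to V$ all of whose line sums in the directions of $D$ are zero, and a switching domain is the support of a switching function. **Theorem.** There are a single program $P$ and an absolute constant $C$, neither depending on $V,m,n,D,f$, with the following property. Given $m$, $n$, the directions of $D$ listed in an arbitrary order, and all the line sums $\ell(a,b,c,f)$, $(a,b)\in D$, $c\in\mathbb{Z}$, of an unknown function $f:A\to V$, the program $P$ halts after at most $C\,d\,m\,n$ basic operations and outputs a function $g:A\to V$ with $$\ell(a,b,c,g)=\ell(a,b,c,f)\qquad\text{for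 all }(a,b)\in D,\ c\in\mathbb{Z},$$ and $g(p,q)=f(p,q)$ for every point $(p,q)\in A$ that does not belong to any switching domain. Here a program is a finite text in an imperative language (sequencing, if–then–else, while loops) acting on finitely many integer registers, two-dimensional integer arrays and two-dimensional arrays with entries in $V$; array indices are integers, the line sum $\ell(a,b,c,f)$ of the $h$-th direction is stored in the cell $(h,c)$ of an input array, and memory that holds no input is initially zero. A basic operation is an addition, subtraction, multiplication, division with remainder (quotient) or comparison of integers, a Boolean operation, an addition or subtraction in $V$, an assignment, a test, or an access to a constant or a memory cell. Elements of $V$ cannot be compared or converted to integers. -/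

import Mathlib

namespace Tomography

/-! ## Grids, directions, line sums, switching domains -/

/-- The `m × n` rectangular grid of lattice points `(p, q)` with `0 ≤ p < m`, `0 ≤ q < n`. -/
noncomputable def grid (m n : ℕ) : Finset (ℤ × ℤ) :=
  Finset.Ico (0 : ℤ) m ×ˢ Finset.Ico (0 : ℤ) n

/-- Primitive lattice directions. As `(a, b)` and `(-a, -b)` are identified, a direction is
represented by its member with `a > 0`, and the vertical one by `(0, 1)`. -/
def IsDirection (v : ℤ × ℤ) : Prop :=
  IsCoprime v.1 v.2 ∧ (0 < v.1 ∨ v = (0, 1))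

/-- The sum of `f` over the grid points `(p, q)` on the lattice line `a q = b p + c`, where
`v = (a, b)`. -/
noncomputable def lineSum {V : Type*} [AddCommGroup V] {m n : ℕ} (v : ℤ × ℤ) (c : ℤ)
    (f : grid m n → V) : V :=
  ∑ x : grid m n, if v.1 * x.1.2 = v.2 * x.1.1 + c then f x else 0

/-- Switching functions (ghosts): all line sums in the directions of `D` vanish. -/
def IsSwitchingFunction {V : Type*} [AddCommGroup V] {m n : ℕ} (D : Finset (ℤ × ℤ))
    (F : grid m n → V) : Prop :=
  ∀ v ∈ D, ∀ c : ℤ, lineSum v c F = 0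

/-- Switching domains are the supports of the `V`-valued switching functions. -/
def IsSwitchingDomain (V : Type*) [AddCommGroup V] {m n : ℕ} (D : Finset (ℤ × ℤ))
    (S : Set (grid m n)) : Prop :=
  ∃ F : grid m n → V, IsSwitchingFunction D F ∧ Function.support F = S

/-! ## The machine model

Programs are finite pieces of text of an imperative language with two sorts of data: integers,
used for the grid, the directions, the indices and the control flow, and *values*, elements of
an abelian group `V` which is not known to the program. Memory consists of integer registers, of
two-dimensional integer arrays and of two-dimensional value arrays. The operations on integers
are `+`, `-`, `*`, `/` and comparison; on values they are only `+`, `-` (and the constant `0`),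
so a program can neither compare values nor convert between values and integers. -/

/-- A memory state. Register `x` holds `reg x`; the cell `(i, j)` of the integer array `A` holds
`intArr A (i, j)`, and that of the value array `A` holds `valArr A (i, j)`. -/
structure State (V : Type*) where
  reg : ℕ → ℤ
  intArr : ℕ → ℤ × ℤ → ℤ
  valArr : ℕ → ℤ × ℤ → V

/-- Integer expressions. -/
inductive IntExpr : Type
  | const (z : ℤ)
  | reg (x : ℕ)
  | get (A : ℕ) (i j : IntExpr)
  | add (e₁ e₂ : IntExpr)
  | sub (e₁ e₂ : IntExpr)
  | mul (e₁ e₂ : IntExpr)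
  | div (e₁ e₂ : IntExpr)

/-- Conditions: comparisons of integers and their Boolean combinations. -/
inductive Cond : Type
  | le (e₁ e₂ : IntExpr)
  | not (c : Cond)
  | and (c₁ c₂ : Cond)

/-- Value expressions. -/
inductive ValExpr : Type
  | zero
  | get (A : ℕ) (i j : IntExpr)
  | add (e₁ e₂ : ValExpr)
  | sub (e₁ e₂ : ValExpr)

/-- Programs. `setReg x e` is the assignment `x ← e`, `setInt A i j e` and `setVal A i j e` are
the assignments `A[i, j] ← e` to a cell of an integer array and of a value array. -/
inductive Program : Type
  | skip
  | setReg (x : ℕ) (e : IntExpr)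
  | setInt (A : ℕ) (i j : IntExpr) (e : IntExpr)
  | setVal (A : ℕ) (i j : IntExpr) (e : ValExpr)
  | seq (P Q : Program)
  | ite (c : Cond) (P Q : Program)
  | while (c : Cond) (P : Program)

/-- The integer denoted by an expression. Division is division with remainder (rounding down
for positive divisors, and with result `0` for the divisor `0`). -/
def IntExpr.eval {V : Type*} (s : State V) : IntExpr → ℤ
  | .const z => z
  | .reg x => s.reg x
  | .get A i j => s.intArr A (i.eval s, j.eval s)
  | .add e₁ e₂ => e₁.eval s + e₂.eval s
  | .sub e₁ e₂ => e₁.eval s - e₂.eval s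
  | .mul e₁ e₂ => e₁.eval s * e₂.eval s
  | .div e₁ e₂ => e₁.eval s / e₂.eval s

/-- The truth value of a condition. -/
def Cond.Holds {V : Type*} (s : State V) : Cond → Prop
  | .le e₁ e₂ => e₁.eval s ≤ e₂.eval s
  | .not c => ¬ c.Holds s
  | .and c₁ c₂ => c₁.Holds s ∧ c₂.Holds s

/-- The element of `V` denoted by a value expression. -/
def ValExpr.eval {V : Type*} [AddCommGroup V] (s : State V) : ValExpr → V
  | .zero => 0
  | .get A i j => s.valArr A (i.eval s, j.eval s)
  | .add e₁ e₂ => e₁.eval s + e₂.eval s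
  | .sub e₁ e₂ => e₁.eval s - e₂.eval s

/-- The number of operations spent on evaluating an integer expression: each arithmetic
operation and each access to a constant, to a register or to an array cell counts as one. -/
def IntExpr.cost : IntExpr → ℕ
  | .const _ => 1
  | .reg _ => 1
  | .get _ i j => i.cost + j.cost + 1
  | .add e₁ e₂ => e₁.cost + e₂.cost + 1
  | .sub e₁ e₂ => e₁.cost + e₂.cost + 1
  | .mul e₁ e₂ => e₁.cost + e₂.cost + 1
  | .div e₁ e₂ => e₁.cost + e₂.cost + 1

/-- The number of operations spent on deciding a condition. -/
def Cond.cost : Cond → ℕ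
  | .le e₁ e₂ => e₁.cost + e₂.cost + 1
  | .not c => c.cost + 1
  | .and c₁ c₂ => c₁.cost + c₂.cost + 1

/-- The number of operations spent on evaluating a value expression. -/
def ValExpr.cost : ValExpr → ℕ
  | .zero => 1
  | .get _ i j => i.cost + j.cost + 1
  | .add e₁ e₂ => e₁.cost + e₂.cost + 1
  | .sub e₁ e₂ => e₁.cost + e₂.cost + 1

/-- The state after `x ← z`. -/
def State.setReg {V : Type*} (s : State V) (x : ℕ) (z : ℤ) : State V :=
  { s with reg := Function.update s.reg x z }

/-- The state after storing `z` in the cell `c` of the integer array `A`. -/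
def State.setInt {V : Type*} (s : State V) (A : ℕ) (c : ℤ × ℤ) (z : ℤ) : State V :=
  { s with intArr := Function.update s.intArr A (Function.update (s.intArr A) c z) }

/-- The state after storing `v` in the cell `c` of the value array `A`. -/
def State.setVal {V : Type*} (s : State V) (A : ℕ) (c : ℤ × ℤ) (v : V) : State V :=
  { s with valArr := Function.update s.valArr A (Function.update (s.valArr A) c v) }

/-- `Exec P s s' k`: started in the state `s`, the program `P` halts in the state `s'` after
exactly `k` basic operations. Each assignment and each test of a condition costs one operation
on top of the evaluation of the expressions in it. -/
inductive Exec {V : Type*} [AddCommGroup V] : Program → State V → State V → ℕ → Prop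
  | skip (s : State V) : Exec .skip s s 1
  | setReg (x : ℕ) (e : IntExpr) (s : State V) :
      Exec (.setReg x e) s (s.setReg x (e.eval s)) (e.cost + 1)
  | setInt (A : ℕ) (i j e : IntExpr) (s : State V) :
      Exec (.setInt A i j e) s (s.setInt A (i.eval s, j.eval s) (e.eval s))
        (i.cost + j.cost + e.cost + 1)
  | setVal (A : ℕ) (i j : IntExpr) (e : ValExpr) (s : State V) :
      Exec (.setVal A i j e) s (s.setVal A (i.eval s, j.eval s) (e.eval s))
        (i.cost + j.cost + e.cost + 1)
  | seq {P Q : Program} {s s' s'' : State V} {k l : ℕ} :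
      Exec P s s' k → Exec Q s' s'' l → Exec (.seq P Q) s s'' (k + l)
  | iteTrue {c : Cond} {P Q : Program} {s s' : State V} {k : ℕ} :
      c.Holds s → Exec P s s' k → Exec (.ite c P Q) s s' (c.cost + 1 + k)
  | iteFalse {c : Cond} {P Q : Program} {s s' : State V} {k : ℕ} :
      ¬ c.Holds s → Exec Q s s' k → Exec (.ite c P Q) s s' (c.cost + 1 + k)
  | whileFalse {c : Cond} {P : Program} {s : State V} :
      ¬ c.Holds s → Exec (.while c P) s s (c.cost + 1)
  | whileTrue {c : Cond} {P : Program} {s s' s'' : State V} {k l : ℕ} :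
      c.Holds s → Exec P s s' k → Exec (.while c P) s' s'' l →
      Exec (.while c P) s s'' (c.cost + 1 + k + l)

/-! ## Input and output -/

/-- The initial state. Registers `0`, `1`, `2` hold `m`, `n` and the number `d` of directions;
row `h` of the integer array `0`, for `0 ≤ h < d`, holds the coordinates of the `h`-th direction
in its cells `(h, 0)` and `(h, 1)`; the cell `(h, c)` of the value array `0` holds the given
line sum `L h c` along the line `a q = b p + c` in the `h`-th direction `(a, b)`. All other
memory is zero. -/
def inputState {V : Type*} [AddCommGroup V] (m n d : ℕ) (dir : Fin d → ℤ × ℤ)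
    (L : Fin d → ℤ → V) : State V where
  reg x := if x = 0 then m else if x = 1 then n else if x = 2 then d else 0
  intArr A c :=
    if h : A = 0 ∧ 0 ≤ c.1 ∧ c.1.toNat < d then
      if c.2 = 0 then (dir ⟨c.1.toNat, h.2.2⟩).1
      else if c.2 = 1 then (dir ⟨c.1.toNat, h.2.2⟩).2
      else 0
    else 0
  valArr A c :=
    if h : A = 0 ∧ 0 ≤ c.1 ∧ c.1.toNat < d then L ⟨c.1.toNat, h.2.2⟩ c.2 else 0

/-- The computed function on the grid: its value at `(p, q)` is read off from the cell `(p, q)`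
of the value array `1`. -/
def output {V : Type*} (m n : ℕ) (s : State V) : grid m n → V :=
  fun x => s.valArr 1 x.1

end Tomography

/-!
A function `g` with the line sums of `f` differs from `f` by a switching function, so it agrees with
`f` outside the switching domains automatically. It remains to find some `g` with the given line sums
in time `O(d m n)`. This is done by Newton interpolation with respect to the directions.

Let `v = (a, b)` be the first direction and put each line sum of `f` in this direction at the first
point of the grid on its line. The resulting function, the *seed*, has the line sums of `f` in the
direction `v` (`planeSum_seed`), so `f - seed` has none, and hence equals `(X ^ a * Y ^ b - 1) f₁` in
terms of generating functions, where `f₁` lives on a grid which is smaller by `a` and `|b|`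
(`exists_eq_spread`). The line sums of `f - seed` in the other directions `u` are known, and they
determine those of `f₁` by running sums, since multiplication by `X ^ a * Y ^ b - 1` shifts and
subtracts line sums, by a nonzero shift as `u ≠ v` (`planeSum_eq_sub_planeSum_spread`). So one
continues with `f₁` and the remaining directions. This ends when no direction is left, in which case
any function does for the last remainder, or when the next direction does not fit into the remaining
grid; then every line has at most one point and the last remainder is read off
(`planeSum_eq_apply`). Going backwards, `g = seed + (X ^ a * Y ^ b - 1) g₁` has the right line sums
whenever `g₁` has those of `f₁` (`Matches.step`).

The number of lines in a direction, and the size of a seed, is `O(|a| n + |b| m)`. While the grid is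
not used up, the `|a|` add up to less than `m` and the `|b|` to less than `n`, so treating all pairs of
directions takes `O(d m n)` operations (`sum_weight_le`, `forward_cost_le`). For this, the line sums
in the direction that ends the process must not be too many either. That is the reason for looking
first for a direction not fitting into the full grid, from which `f` is read off at once.

Programs are verified with a Hoare-style predicate `Runs` that includes a bound for the cost.
-/

namespace Tomography

/-! ### Line sums in the plane -/

section

variable {V : Type*} [AddCommGroup V]

/-- The lattice points `(p, q)` with `0 ≤ p < M` and `0 ≤ q < N`. The sides are integers, so that
sides which have become negative give the empty box. -/
def box (M N : ℤ) : Set (ℤ × ℤ) := {x | (0 ≤ x.1 ∧ x.1 < M) ∧ 0 ≤ x.2 ∧ x.2 < N}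

theorem mem_box {M N : ℤ} {x : ℤ × ℤ} :
    x ∈ box M N ↔ (0 ≤ x.1 ∧ x.1 < M) ∧ 0 ≤ x.2 ∧ x.2 < N := Iff.rfl

instance (M N : ℤ) (x : ℤ × ℤ) : Decidable (x ∈ box M N) :=
  inferInstanceAs (Decidable ((0 ≤ x.1 ∧ x.1 < M) ∧ 0 ≤ x.2 ∧ x.2 < N))

theorem box_finite (M N : ℤ) : (box M N).Finite :=
  ((Set.finite_Ico 0 M).prod (Set.finite_Ico 0 N)).subset fun _ hx => hx

/-- The number `c` of the line `a q = b p + c` in the direction `v = (a, b)` through `x`. -/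
def lineIndex (v x : ℤ × ℤ) : ℤ := v.1 * x.2 - v.2 * x.1

/-- The line sum of a finitely supported function on the whole plane. Working on `ℤ × ℤ` instead
of a grid makes translation available. The value is `0` if infinitely many summands are nonzero. -/
noncomputable def planeSum (v : ℤ × ℤ) (F : ℤ × ℤ → V) (c : ℤ) : V :=
  ∑ᶠ x, if lineIndex v x = c then F x else 0

/-- In terms of generating functions, `spread (a, b)` is multiplication by `X ^ a * Y ^ b - 1`,
and by `X ^ a - Y ^ (-b)` if `b < 0`: the normalisation of `X ^ a * Y ^ b - 1` that has no negative
exponents, so that boxes stay anchored at the origin. -/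
def spread (v : ℤ × ℤ) (G : ℤ × ℤ → V) (x : ℤ × ℤ) : V :=
  G (x - (v.1, max v.2 0)) - G (x - (0, max (-v.2) 0))

/-- The function that places the value `L c` at the first point (in the direction `v`) of the
intersection of the line number `c` with the box. -/
def seed (M N : ℤ) (v : ℤ × ℤ) (L : ℤ → V) (x : ℤ × ℤ) : V :=
  if x ∈ box M N ∧ x - v ∉ box M N then L (lineIndex v x) else 0

theorem IsDirection.fst_nonneg {v : ℤ × ℤ} (hv : IsDirection v) : 0 ≤ v.1 := by
  rcases hv.2 with h | h
  · exact h.le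
  · simp [h]

theorem IsDirection.normSq_pos {v : ℤ × ℤ} (hv : IsDirection v) : 0 < v.1 * v.1 + v.2 * v.2 := by
  rcases hv.2 with h | h
  · nlinarith [mul_self_nonneg v.2]
  · simp [h]

/-- Two lattice points on the same line of a primitive direction `v` differ by a multiple of `v`. -/
theorem IsDirection.exists_eq_add_smul {v : ℤ × ℤ} (hv : IsDirection v) {x y : ℤ × ℤ}
    (h : lineIndex v y = lineIndex v x) : ∃ t : ℤ, y = x + t • v := by
  obtain ⟨r, s, hrs⟩ := hv.1
  simp only [lineIndex] at h
  refine ⟨r * (y.1 - x.1) + s * (y.2 - x.2), ?_⟩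
  ext
  · simp only [Prod.fst_add, Prod.smul_fst, smul_eq_mul]
    linear_combination (-(y.1 - x.1)) * hrs - s * h
  · simp only [Prod.snd_add, Prod.smul_snd, smul_eq_mul]
    linear_combination (-(y.2 - x.2)) * hrs + r * h

theorem IsDirection.det_ne_zero {u v : ℤ × ℤ} (hu : IsDirection u) (hv : IsDirection v)
    (huv : u ≠ v) : u.1 * v.2 - u.2 * v.1 ≠ 0 := by
  intro h
  have h1 : u.1 ∣ v.1 := hu.1.dvd_of_dvd_mul_left ⟨v.2, by linarith⟩
  have h2 : v.1 ∣ u.1 := hv.1.dvd_of_dvd_mul_right ⟨u.2, by linarith⟩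
  have h3 : u.1 = v.1 := Int.dvd_antisymm hu.fst_nonneg hv.fst_nonneg h1 h2
  apply huv
  rcases hu.2 with hu' | hu'
  · refine Prod.ext h3 ?_
    have : u.1 * (v.2 - u.2) = 0 := by rw [← h3] at h; linarith
    rcases mul_eq_zero.mp this with h | h <;> omega
  · rcases hv.2 with hv' | hv'
    · rw [hu'] at h3; simp at h3; omega
    · rw [hu', hv']

theorem finite_support_ite {F : ℤ × ℤ → V} (hF : F.support.Finite) (p : ℤ × ℤ → Prop)
    [DecidablePred p] : (Function.support fun x => if p x then F x else 0).Finite :=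
  hF.subset fun x hx => by
    simp only [Function.mem_support, ne_eq, ite_eq_right_iff, not_forall] at hx ⊢
    exact hx.2

theorem planeSum_add {F G : ℤ × ℤ → V} (hF : F.support.Finite) (hG : G.support.Finite)
    (v : ℤ × ℤ) (c : ℤ) :
    planeSum v (fun x => F x + G x) c = planeSum v F c + planeSum v G c := by
  simp only [planeSum]
  rw [← finsum_add_distrib (finite_support_ite hF _) (finite_support_ite hG _)]
  exact finsum_congr fun x => by split_ifs <;> simp

theorem planeSum_sub {F G : ℤ × ℤ → V} (hF : F.support.Finite) (hG : G.support.Finite)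
    (v : ℤ × ℤ) (c : ℤ) :
    planeSum v (fun x => F x - G x) c = planeSum v F c - planeSum v G c := by
  simp only [planeSum]
  rw [← finsum_sub_distrib (finite_support_ite hF _) (finite_support_ite hG _)]
  exact finsum_congr fun x => by split_ifs <;> simp

theorem planeSum_translate (v w : ℤ × ℤ) (F : ℤ × ℤ → V) (c : ℤ) :
    planeSum v (fun x => F (x - w)) c = planeSum v F (c - lineIndex v w) := by
  simp only [planeSum]
  rw [← finsum_comp_equiv (Equiv.addRight w)]
  refine finsum_congr fun x => ?_
  have : lineIndex v (x + w) = c ↔ lineIndex v x = c - lineIndex v w := by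
    simp only [lineIndex, Prod.fst_add, Prod.snd_add]
    constructor <;> intro h <;> linarith
  simp [this]

theorem finite_support_translate {F : ℤ × ℤ → V} (hF : F.support.Finite) (w : ℤ × ℤ) :
    (Function.support fun x => F (x - w)).Finite :=
  (hF.image (· + w)).subset fun x hx => ⟨x - w, hx, by simp⟩

theorem finite_support_spread {F : ℤ × ℤ → V} (hF : F.support.Finite) (v : ℤ × ℤ) :
    (spread v F).support.Finite :=
  ((finite_support_translate hF _).union (finite_support_translate hF _)).subset
    (Function.support_sub _ _)

/-- Both translates in `spread v G` move the lines in the direction `u` by a fixed number of steps. -/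
theorem planeSum_spread {G : ℤ × ℤ → V} (hG : G.support.Finite) (u v : ℤ × ℤ) (c : ℤ) :
    planeSum u (spread v G) c = planeSum u G (c - (u.1 * max v.2 0 - u.2 * v.1)) -
      planeSum u G (c - u.1 * max (-v.2) 0) := by
  have := planeSum_sub (finite_support_translate hG (v.1, max v.2 0))
    (finite_support_translate hG (0, max (-v.2) 0)) u c
  rw [planeSum_translate, planeSum_translate] at this
  simp only [lineIndex, mul_zero, sub_zero] at this
  exact this

theorem planeSum_spread_self {G : ℤ × ℤ → V} (hG : G.support.Finite) (v : ℤ × ℤ) (c : ℤ) :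
    planeSum v (spread v G) c = 0 := by
  rw [planeSum_spread hG]
  have : v.1 * max v.2 0 - v.2 * v.1 = v.1 * max (-v.2) 0 := by
    have : max v.2 0 = v.2 + max (-v.2) 0 := by omega
    rw [this]; ring
  rw [this, sub_self]

/-- The recurrence by which the line sums of `G` are obtained from those of `spread v G`. -/
theorem planeSum_eq_sub_planeSum_spread {G : ℤ × ℤ → V} (hG : G.support.Finite) (u v : ℤ × ℤ)
    (c : ℤ) : planeSum u G c = planeSum u G (c - (u.1 * v.2 - u.2 * v.1)) -
      planeSum u (spread v G) (c + u.1 * max (-v.2) 0) := by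
  rw [planeSum_spread hG]
  have h : max v.2 0 = v.2 + max (-v.2) 0 := by omega
  have h1 : c + u.1 * max (-v.2) 0 - (u.1 * max v.2 0 - u.2 * v.1) =
      c - (u.1 * v.2 - u.2 * v.1) := by rw [h]; ring
  rw [h1, add_sub_cancel_right]
  abel

/-- Boxes are convex. -/
theorem add_smul_mem_box {M N : ℤ} {v x : ℤ × ℤ} {s t : ℤ} (hx : x ∈ box M N)
    (hy : x + t • v ∈ box M N) (hs : 0 ≤ s) (hst : s ≤ t) : x + s • v ∈ box M N := by
  simp only [mem_box, Prod.fst_add, Prod.snd_add, Prod.smul_fst, Prod.smul_snd, smul_eq_mul]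
    at hx hy ⊢
  have key : ∀ w : ℤ, (0 ≤ s * w ∧ s * w ≤ t * w) ∨ (s * w ≤ 0 ∧ t * w ≤ s * w) := by
    intro w
    rcases le_total 0 w with h | h
    · exact Or.inl ⟨mul_nonneg hs h, mul_le_mul_of_nonneg_right hst h⟩
    · exact Or.inr ⟨mul_nonpos_of_nonneg_of_nonpos hs h, mul_le_mul_of_nonpos_right hst h⟩
  rcases key v.1 with h1 | h1 <;> rcases key v.2 with h2 | h2 <;> omega

theorem finite_support_of_subset_box {M N : ℤ} {F : ℤ × ℤ → V} (hF : F.support ⊆ box M N) :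
    F.support.Finite := (box_finite M N).subset hF

theorem support_seed_subset (M N : ℤ) (v : ℤ × ℤ) (L : ℤ → V) :
    (seed M N v L).support ⊆ box M N := fun x hx => by
  simp only [Function.mem_support, seed, ne_eq, ite_eq_right_iff, not_forall] at hx
  exact hx.1.1

/-- A line meeting the box has exactly one point in the box whose predecessor lies outside, so
placing the line sum there reproduces it. -/
theorem planeSum_seed {M N : ℤ} {v : ℤ × ℤ} (hv : IsDirection v) {F : ℤ × ℤ → V}
    (hF : F.support ⊆ box M N) (c : ℤ) :
    planeSum v (seed M N v (planeSum v F)) c = planeSum v F c := by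
  by_cases hc : ∃ x ∈ box M N, lineIndex v x = c
  · have hfin : (box M N ∩ {x | lineIndex v x = c}).Finite := (box_finite M N).inter_of_left _
    obtain ⟨x, ⟨hx, hxc : lineIndex v x = c⟩, hmin⟩ := Set.exists_min_image _ (fun x => v.1 * x.1 + v.2 * x.2) hfin
      (by obtain ⟨x, h1, h2⟩ := hc; exact ⟨x, h1, h2⟩)
    have hx' : x - v ∉ box M N := by
      intro h
      have hl : lineIndex v (x - v) = c := by
        simp only [lineIndex, Prod.fst_sub, Prod.snd_sub] at hxc ⊢
        linarith
      have := hmin (x - v) ⟨h, hl⟩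
      have h2 := hv.normSq_pos
      simp only [Prod.fst_sub, Prod.snd_sub] at this
      nlinarith
    conv_lhs => rw [planeSum]
    rw [finsum_eq_single _ x]
    · rw [if_pos hxc, seed, if_pos ⟨hx, hx'⟩, hxc]
    · intro y hy
      by_contra hne
      simp only [ite_eq_right_iff, not_forall] at hne
      obtain ⟨hyc, hne⟩ := hne
      simp only [seed, ite_eq_right_iff, not_forall] at hne
      obtain ⟨⟨hy1, hy2⟩, -⟩ := hne
      obtain ⟨t, rfl⟩ := hv.exists_eq_add_smul (hyc.trans hxc.symm)
      rcases lt_trichotomy t 0 with ht | ht | ht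
      · apply hx'
        have := add_smul_mem_box (v := v) (s := -t - 1) (t := -t) hy1 (by simpa using hx)
          (by omega) (by omega)
        convert this using 1
        module
      · simp [ht] at hy
      · apply hy2
        have := add_smul_mem_box (v := v) (s := t - 1) (t := t) hx hy1 (by omega) (by omega)
        convert this using 1
        module
  · push Not at hc
    simp only [planeSum]
    refine finsum_congr fun x => ?_
    split_ifs with h
    · have hx : x ∉ box M N := fun hx => hc x hx h
      rw [Function.notMem_support.mp fun h => hx (hF h),
        Function.notMem_support.mp fun h => hx (support_seed_subset _ _ _ _ h)]
    · rfl

/-- A function on the box with vanishing line sums in the direction `v` is a difference of two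
translates of a function on a smaller box: the partial sums along the lines. -/
theorem exists_eq_spread {M N : ℤ} {v : ℤ × ℤ} (hv : IsDirection v) {F : ℤ × ℤ → V}
    (hF : F.support ⊆ box M N) (h0 : ∀ c, planeSum v F c = 0) :
    ∃ G : ℤ × ℤ → V, G.support ⊆ box (M - v.1) (N - |v.2|) ∧ F = spread v G := by
  have hfin := finite_support_of_subset_box hF
  have hn := hv.normSq_pos
  -- `ψ` orders the points of a line; `H x` is the negated sum of `F` over the points up to `x`.
  let ψ : ℤ × ℤ → ℤ := fun x => v.1 * x.1 + v.2 * x.2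
  have hψ : ∀ x (t : ℤ), ψ (x + t • v) = ψ x + t * (v.1 * v.1 + v.2 * v.2) := by
    intro x t; simp [ψ]; ring
  let H : ℤ × ℤ → V := fun x =>
    -∑ᶠ y, if lineIndex v y = lineIndex v x ∧ ψ y ≤ ψ x then F y else 0
  have hstep : ∀ x, F x = H (x - v) - H x := by
    intro x
    have e1 : lineIndex v (x - v) = lineIndex v x := by
      simp [lineIndex]; ring
    have e2 : ψ (x - v) = ψ x - (v.1 * v.1 + v.2 * v.2) := by
      simp [ψ]; ring
    simp only [H, e1, e2]
    rw [neg_sub_neg, ← finsum_sub_distrib (finite_support_ite hfin _) (finite_support_ite hfin _),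
      finsum_eq_single _ x]
    · rw [if_pos ⟨rfl, le_rfl⟩, if_neg (by rintro ⟨-, h⟩; omega), sub_zero]
    · intro y hy
      by_cases hl : lineIndex v y = lineIndex v x
      · obtain ⟨t, rfl⟩ := hv.exists_eq_add_smul hl
        have ht : t ≠ 0 := by rintro rfl; simp at hy
        have : ψ (x + t • v) ≤ ψ x ↔ ψ (x + t • v) ≤ ψ x - (v.1 * v.1 + v.2 * v.2) := by
          rw [hψ]
          constructor
          · intro h
            have : t ≤ -1 := by
              by_contra h'
              have : 1 ≤ t := by omega
              nlinarith
            nlinarith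
          · intro h; omega
        simp only [this, sub_self]
      · simp [hl]
  have hsupp : ∀ x, H x ≠ 0 → (∃ t : ℤ, t ≤ 0 ∧ x + t • v ∈ box M N) ∧
      ∃ t : ℤ, 1 ≤ t ∧ x + t • v ∈ box M N := by
    intro x hx
    have hx1 : (∑ᶠ y, if lineIndex v y = lineIndex v x ∧ ψ y ≤ ψ x then F y else 0) ≠ 0 := by
      intro h; exact hx (by simp only [H, h, neg_zero])
    -- The total sum vanishes, so the sum over the points beyond `x` is nonzero too.
    have hx2 : (∑ᶠ y, if lineIndex v y = lineIndex v x ∧ ¬ ψ y ≤ ψ x then F y else 0) ≠ 0 := by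
      intro h
      have hsum := finsum_add_distrib
        (finite_support_ite hfin fun y => lineIndex v y = lineIndex v x ∧ ψ y ≤ ψ x)
        (finite_support_ite hfin fun y => lineIndex v y = lineIndex v x ∧ ¬ ψ y ≤ ψ x)
      rw [h, add_zero] at hsum
      rw [← hsum] at hx1
      apply hx1
      refine Eq.trans ?_ (h0 (lineIndex v x))
      refine finsum_congr fun y => ?_
      by_cases h1 : lineIndex v y = lineIndex v x <;> by_cases h2 : ψ y ≤ ψ x <;> simp [h1, h2]
    constructor
    · obtain ⟨y, hy⟩ := not_forall.mp (mt finsum_eq_zero_of_forall_eq_zero hx1)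
      simp only [ite_eq_right_iff, not_forall] at hy
      obtain ⟨⟨hl, hle⟩, hy⟩ := hy
      obtain ⟨t, rfl⟩ := hv.exists_eq_add_smul hl
      refine ⟨t, ?_, hF hy⟩
      rw [hψ] at hle
      by_contra h'
      nlinarith
    · obtain ⟨y, hy⟩ := not_forall.mp (mt finsum_eq_zero_of_forall_eq_zero hx2)
      simp only [ite_eq_right_iff, not_forall] at hy
      obtain ⟨⟨hl, hle⟩, hy⟩ := hy
      obtain ⟨t, rfl⟩ := hv.exists_eq_add_smul hl
      refine ⟨t, ?_, hF hy⟩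
      rw [hψ] at hle
      by_contra h'
      have : t ≤ 0 := by omega
      nlinarith
  refine ⟨fun x => H (x + (0, max (-v.2) 0)), fun x hx => ?_, ?_⟩
  -- Both `x` (after undoing the shift) and its successor lie between two points of the box.
  · obtain ⟨⟨t, ht, h1⟩, ⟨t', ht', h2⟩⟩ := hsupp _ hx
    have ha := hv.fst_nonneg
    have e1 : x + (0, max (-v.2) 0) ∈ box M N := by
      have := add_smul_mem_box (v := v) (s := -t) (t := t' - t) h1
        (by convert h2 using 1; module) (by omega) (by omega)
      convert this using 1; module
    have e2 : x + (0, max (-v.2) 0) + v ∈ box M N := by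
      have := add_smul_mem_box (v := v) (s := 1 - t) (t := t' - t) h1
        (by convert h2 using 1; module) (by omega) (by omega)
      convert this using 1; module
    simp only [mem_box, Prod.fst_add, Prod.snd_add] at e1 e2 ⊢
    rcases abs_cases v.2 with h | h <;> omega
  · funext x
    rw [hstep x, spread]
    congr 2
    · ext
      · simp
      · simp; omega
    · simp

/-- If a direction does not fit into the box, every line meets the box in at most one point. -/
theorem planeSum_eq_apply {M N : ℤ} {v : ℤ × ℤ} (hv : IsDirection v) {F : ℤ × ℤ → V}
    (hF : F.support ⊆ box M N) (h : M ≤ v.1 ∨ N ≤ |v.2|) {x : ℤ × ℤ} (hx : x ∈ box M N) :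
    planeSum v F (lineIndex v x) = F x := by
  rw [planeSum, finsum_eq_single _ x]
  · simp
  · intro y hy
    by_contra hne
    simp only [ite_eq_right_iff, not_forall] at hne
    obtain ⟨hl, hne⟩ := hne
    obtain ⟨t, rfl⟩ := hv.exists_eq_add_smul hl
    have hy' := hF hne
    have ht : t ≠ 0 := by rintro rfl; simp at hy
    simp only [mem_box, Prod.fst_add, Prod.snd_add, Prod.smul_fst, Prod.smul_snd, smul_eq_mul]
      at hx hy'
    have key : ∀ w : ℤ, |w| ≤ |t * w| := fun w => by
      rw [abs_mul]
      exact le_mul_of_one_le_left (abs_nonneg w) (Int.one_le_abs ht)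
    have h1 := key v.1
    have h2 := key v.2
    rw [abs_of_nonneg hv.fst_nonneg] at h1
    rcases h with h | h
    · rcases abs_cases (t * v.1) with h3 | h3 <;> omega
    · rcases abs_cases (t * v.2) with h3 | h3 <;> omega

theorem planeSum_eq_sum {M N : ℕ} {F : ℤ × ℤ → V} (hF : F.support ⊆ box M N) (v : ℤ × ℤ)
    (c : ℤ) : planeSum v F c = ∑ p ∈ Finset.range M, ∑ q ∈ Finset.range N,
      if lineIndex v ((p : ℤ), (q : ℤ)) = c then F ((p : ℤ), (q : ℤ)) else 0 := by
  rw [planeSum, ← Finset.sum_product', finsum_eq_sum_of_support_subset (s :=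
    (Finset.range M ×ˢ Finset.range N).image fun x : ℕ × ℕ => ((x.1 : ℤ), (x.2 : ℤ))),
    Finset.sum_image]
  · intro x _ y _ h
    simpa [Prod.ext_iff] using h
  · intro x hx
    have hx' : x ∈ box M N := hF fun h => hx (by simp [h])
    rw [mem_box] at hx'
    simp only [Finset.coe_image, Set.mem_image, Finset.mem_coe, Finset.mem_product,
      Finset.mem_range, Prod.exists]
    exact ⟨x.1.toNat, x.2.toNat, by omega, by ext <;> simp <;> omega⟩

theorem planeSum_eq_zero_of_notMem {m n M N : ℤ} {v : ℤ × ℤ} (hv : IsDirection v)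
    {F : ℤ × ℤ → V} (hF : F.support ⊆ box M N) (hM : M ≤ m) (hN : N ≤ n) {c : ℤ}
    (hc : c < -(max v.2 0 * m) ∨ v.1 * n + max (-v.2) 0 * m < c) : planeSum v F c = 0 := by
  rw [planeSum]
  refine finsum_eq_zero_of_forall_eq_zero fun x => ?_
  by_contra hne
  simp only [ite_eq_right_iff, not_forall] at hne
  obtain ⟨hl, hne⟩ := hne
  have hx := hF hne
  rw [mem_box] at hx
  have ha := hv.fst_nonneg
  rw [lineIndex] at hl
  have h1 : 0 ≤ v.1 * x.2 := mul_nonneg ha hx.2.1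
  have h2 : v.1 * x.2 ≤ v.1 * n := mul_le_mul_of_nonneg_left (by omega) ha
  have h3 : v.2 * x.1 ≤ max v.2 0 * m :=
    (mul_le_mul_of_nonneg_right (le_max_left v.2 0) hx.1.1).trans
      (mul_le_mul_of_nonneg_left (by omega) (le_max_right _ _))
  have h4 : -v.2 * x.1 ≤ max (-v.2) 0 * m :=
    (mul_le_mul_of_nonneg_right (le_max_left (-v.2) 0) hx.1.1).trans
      (mul_le_mul_of_nonneg_left (by omega) (le_max_right _ _))
  rw [neg_mul] at h4
  omega

end

/-! ### Reasoning about programs -/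

section

variable {V : Type*}

/-- Only registers with numbers at least `r` differ between `s` and `s'`. Subprograms use
registers in the manner of a stack, so that this is all that is needed to know that a loop body
leaves the registers of the enclosing program alone. -/
def Keeps (r : ℕ) (s s' : State V) : Prop := ∀ x < r, s'.reg x = s.reg x

theorem Keeps.refl (r : ℕ) (s : State V) : Keeps r s s := fun _ _ => rfl

theorem Keeps.trans {r : ℕ} {s s' s'' : State V} (h : Keeps r s s') (h' : Keeps r s' s'') :
    Keeps r s s'' := fun x hx => (h' x hx).trans (h x hx)

theorem Keeps.mono {r r' : ℕ} {s s' : State V} (h : Keeps r s s') (hr : r' ≤ r) :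
    Keeps r' s s' := fun x hx => h x (hx.trans_le hr)

theorem Keeps.setReg {r x : ℕ} (s : State V) (z : ℤ) (hx : r ≤ x) :
    Keeps r s (s.setReg x z) := fun y hy => by
  simp [State.setReg, Function.update_of_ne (by omega : y ≠ x)]

/-- The strict comparison of integers. -/
def Cond.lt (e e' : IntExpr) : Cond := .not (.le e' e)

theorem Cond.holds_lt {e e' : IntExpr} {s : State V} :
    (Cond.lt e e').Holds s ↔ e.eval s < e'.eval s := not_le

variable [AddCommGroup V]

/-- Started in `s`, the program `P` halts after at most `B` operations in a state satisfying `Q`. -/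
def Runs (P : Program) (s : State V) (B : ℕ) (Q : State V → Prop) : Prop :=
  ∃ s' k, Exec P s s' k ∧ k ≤ B ∧ Q s'

theorem Runs.mono {P : Program} {s : State V} {B B' : ℕ} {Q Q' : State V → Prop}
    (h : Runs P s B Q) (hB : B ≤ B') (hQ : ∀ s', Q s' → Q' s') : Runs P s B' Q' :=
  let ⟨s', k, h1, h2, h3⟩ := h
  ⟨s', k, h1, h2.trans hB, hQ s' h3⟩

theorem Runs.skip {s : State V} {Q : State V → Prop} (h : Q s) : Runs .skip s 1 Q :=
  ⟨s, 1, .skip s, le_rfl, h⟩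

theorem Runs.setReg {x : ℕ} {e : IntExpr} {s : State V} {Q : State V → Prop}
    (h : Q (s.setReg x (e.eval s))) : Runs (.setReg x e) s (e.cost + 1) Q :=
  ⟨_, _, .setReg x e s, le_rfl, h⟩

theorem Runs.setInt {A : ℕ} {i j e : IntExpr} {s : State V} {Q : State V → Prop}
    (h : Q (s.setInt A (i.eval s, j.eval s) (e.eval s))) :
    Runs (.setInt A i j e) s (i.cost + j.cost + e.cost + 1) Q :=
  ⟨_, _, .setInt A i j e s, le_rfl, h⟩

theorem Runs.setVal {A : ℕ} {i j : IntExpr} {e : ValExpr} {s : State V} {Q : State V → Prop}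
    (h : Q (s.setVal A (i.eval s, j.eval s) (e.eval s))) :
    Runs (.setVal A i j e) s (i.cost + j.cost + e.cost + 1) Q :=
  ⟨_, _, .setVal A i j e s, le_rfl, h⟩

theorem Runs.seq {P P' : Program} {s : State V} {B B' : ℕ} {R Q : State V → Prop}
    (h : Runs P s B R) (h' : ∀ s', R s' → Runs P' s' B' Q) : Runs (.seq P P') s (B + B') Q :=
  let ⟨s', _, h1, h2, h3⟩ := h
  let ⟨s'', _, h4, h5, h6⟩ := h' s' h3
  ⟨s'', _, .seq h1 h4, Nat.add_le_add h2 h5, h6⟩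

theorem Runs.ite {c : Cond} {P P' : Program} {s : State V} {B : ℕ} {Q : State V → Prop}
    (h : c.Holds s → Runs P s B Q) (h' : ¬ c.Holds s → Runs P' s B Q) :
    Runs (.ite c P P') s (c.cost + 1 + B) Q := by
  by_cases hc : c.Holds s
  · obtain ⟨s', _, h1, h2, h3⟩ := h hc
    exact ⟨s', _, .iteTrue hc h1, Nat.add_le_add_left h2 _, h3⟩
  · obtain ⟨s', _, h1, h2, h3⟩ := h' hc
    exact ⟨s', _, .iteFalse hc h1, Nat.add_le_add_left h2 _, h3⟩

/-- `while x < e do (body; x ← x + 1)`. -/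
def countLoop (x : ℕ) (e : IntExpr) (body : Program) : Program :=
  .while (.lt (.reg x) e) (.seq body (.setReg x (.add (.reg x) (.const 1))))

/-- `for x from e₀ to e - 1 do body`. -/
def forLoop (x : ℕ) (e₀ e : IntExpr) (body : Program) : Program :=
  .seq (.setReg x e₀) (countLoop x e body)

theorem runs_countLoop {x : ℕ} {e : IntExpr} {body : Program} {s₀ : State V} {hi : ℕ}
    {B : ℕ → ℕ} {A : ℕ → (ℕ → ℤ × ℤ → ℤ) → (ℕ → ℤ × ℤ → V) → Prop} (l : ℕ) :
    ∀ (i : ℕ) (s : State V), i + l = hi →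
    (∀ j s, i ≤ j → j < hi → Keeps x s₀ s → s.reg x = j → A j s.intArr s.valArr →
      Runs body s (B j) fun s' => Keeps (x + 1) s s' ∧ A (j + 1) s'.intArr s'.valArr) →
    (∀ j s, i ≤ j → j ≤ hi → Keeps x s₀ s → A j s.intArr s.valArr → e.eval s = hi) →
    Keeps x s₀ s → s.reg x = i → A i s.intArr s.valArr →
    Runs (countLoop x e body) s (∑ j ∈ Finset.Ico i hi, (B j + (e.cost + 8)) + (e.cost + 4))
      fun s' => Keeps x s₀ s' ∧ A hi s'.intArr s'.valArr := by
  induction l with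
  | zero =>
    intro i s hi' _ he hk hx hA
    subst hi'
    refine ⟨s, _, .whileFalse ?_, ?_, hk, hA⟩
    · rw [Cond.holds_lt, he i s le_rfl le_rfl hk hA, IntExpr.eval, hx]
      simp
    · simp only [Cond.lt, Cond.cost, IntExpr.cost, add_zero, Finset.Ico_self, Finset.sum_empty]
      omega
  | succ l ih =>
    intro i s hi' hbody he hk hx hA
    obtain ⟨s', k, hex, hkB, hks, hA'⟩ := hbody i s le_rfl (by omega) hk hx hA
    have hk' : Keeps x s₀ s' := hk.trans (hks.mono (Nat.le_succ x))
    have hx' : s'.reg x = i := (hks x (Nat.lt_succ_self x)).trans hx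
    obtain ⟨s'', k', hex', hkB', hQ⟩ := ih (i + 1) (s'.setReg x (i + 1 : ℕ)) (by omega)
      (fun j s hj => hbody j s (by omega)) (fun j s hj => he j s (by omega))
      (hk'.trans (Keeps.setReg s' _ le_rfl)) (by simp [State.setReg]) hA'
    have hset : Exec (.setReg x (.add (.reg x) (.const 1))) s' (s'.setReg x (i + 1 : ℕ)) 4 := by
      have := Exec.setReg x (.add (.reg x) (.const 1)) s'
      simp only [IntExpr.eval, hx', IntExpr.cost] at this
      exact_mod_cast this
    refine ⟨s'', _, .whileTrue ?_ (.seq hex hset) hex', ?_, hQ⟩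
    · rw [Cond.holds_lt, he i s le_rfl (by omega) hk hA, IntExpr.eval, hx]
      omega
    · rw [Finset.sum_eq_sum_Ico_succ_bot (by omega)]
      simp only [Cond.lt, Cond.cost, IntExpr.cost]
      omega

theorem runs_forLoop' {x : ℕ} {e₀ e : IntExpr} {body : Program} {s₀ : State V} {lo hi : ℕ}
    {B : ℕ → ℕ} (A : ℕ → (ℕ → ℤ × ℤ → ℤ) → (ℕ → ℤ × ℤ → V) → Prop) (hle : lo ≤ hi)
    (h₀ : e₀.eval s₀ = lo)
    (he : ∀ j s, lo ≤ j → j ≤ hi → Keeps x s₀ s → A j s.intArr s.valArr → e.eval s = hi)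
    (hA : A lo s₀.intArr s₀.valArr)
    (hbody : ∀ j s, lo ≤ j → j < hi → Keeps x s₀ s → s.reg x = j → A j s.intArr s.valArr →
      Runs body s (B j) fun s' => Keeps (x + 1) s s' ∧ A (j + 1) s'.intArr s'.valArr) :
    Runs (forLoop x e₀ e body) s₀
      (∑ j ∈ Finset.Ico lo hi, (B j + (e.cost + 8)) + (e₀.cost + e.cost + 5))
      fun s' => Keeps x s₀ s' ∧ A hi s'.intArr s'.valArr := by
  refine (Runs.seq (R := fun s => s = s₀.setReg x lo) (Runs.setReg (by rw [h₀]))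
    (B' := ∑ j ∈ Finset.Ico lo hi, (B j + (e.cost + 8)) + (e.cost + 4)) ?_).mono
    (by omega) fun _ h => h
  rintro _ rfl
  exact runs_countLoop (hi - lo) lo _ (by omega) hbody he (Keeps.setReg _ _ le_rfl)
    (by simp [State.setReg]) hA

/-- The rule for counting loops whose body does not write to integer arrays: `A j` is the
invariant on the value arrays before the round with counter `j`, and `B j` bounds the cost of
that round. -/
theorem runs_forLoop {x : ℕ} {e₀ e : IntExpr} {body : Program} {s₀ : State V} {lo hi : ℕ}
    {B : ℕ → ℕ} (A : ℕ → (ℕ → ℤ × ℤ → V) → Prop) (hle : lo ≤ hi)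
    (h₀ : e₀.eval s₀ = lo)
    (he : ∀ s, Keeps x s₀ s → s.intArr = s₀.intArr → e.eval s = hi)
    (hA : A lo s₀.valArr)
    (hbody : ∀ j s, lo ≤ j → j < hi → Keeps x s₀ s → s.intArr = s₀.intArr → s.reg x = j →
      A j s.valArr → Runs body s (B j) fun s' =>
        (Keeps (x + 1) s s' ∧ s'.intArr = s.intArr) ∧ A (j + 1) s'.valArr) :
    Runs (forLoop x e₀ e body) s₀
      (∑ j ∈ Finset.Ico lo hi, (B j + (e.cost + 8)) + (e₀.cost + e.cost + 5))
      fun s' => (Keeps x s₀ s' ∧ s'.intArr = s₀.intArr) ∧ A hi s'.valArr := by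
  refine (runs_forLoop' (fun j I W => I = s₀.intArr ∧ A j W) hle h₀
    (fun j s _ _ hk h => he s hk h.1) ⟨rfl, hA⟩ fun j s h1 h2 hk hx h => ?_).mono le_rfl
    fun s' h => ⟨⟨h.1, h.2.1⟩, h.2.2⟩
  exact (hbody j s h1 h2 hk h.1 hx h.2).mono le_rfl
    fun s' h' => ⟨h'.1.1, h'.1.2.trans h.1, h'.2⟩

/-- `x ← 0; while c do x ← x + 1`. -/
def search (x : ℕ) (c : Cond) : Program :=
  .seq (.setReg x (.const 0)) (.while c (.setReg x (.add (.reg x) (.const 1))))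

/-- A search finds the first number not satisfying the condition `p` that the test `c`
expresses. -/
theorem runs_search {x : ℕ} {c : Cond} {s₀ : State V} {k : ℕ} {p : ℕ → Prop}
    (hc : ∀ j : ℕ, c.Holds (s₀.setReg x j) ↔ p j) (hp : ∀ j < k, p j) (hk : ¬ p k) :
    Runs (search x c) s₀ (k * (c.cost + 5) + c.cost + 3) fun s' => s' = s₀.setReg x k := by
  have key : ∀ l j, j + l = k →
      Runs (.while c (.setReg x (.add (.reg x) (.const 1)))) (s₀.setReg x j)
        (l * (c.cost + 5) + c.cost + 1) fun s' => s' = s₀.setReg x k := by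
    intro l
    induction l with
    | zero =>
      rintro j hj
      obtain rfl : j = k := by omega
      exact ⟨_, _, .whileFalse (by rwa [hc]), by omega, rfl⟩
    | succ l ih =>
      intro j hj
      obtain ⟨s', n, h1, h2, h3⟩ := ih (j + 1) (by omega)
      have hset : Exec (.setReg x (.add (.reg x) (.const 1))) (s₀.setReg x j)
          (s₀.setReg x (j + 1 : ℕ)) 4 := by
        have := Exec.setReg x (.add (.reg x) (.const 1)) (s₀.setReg x j)
        simpa [IntExpr.eval, IntExpr.cost, State.setReg] using this
      refine ⟨s', _, .whileTrue ((hc j).mpr (hp j (by omega))) hset h1, ?_, h3⟩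
      rw [Nat.succ_mul]
      omega
  refine (Runs.seq (R := fun s => s = s₀.setReg x (0 : ℕ)) (Runs.setReg ?_)
    (B' := k * (c.cost + 5) + c.cost + 1) ?_).mono ?_ fun _ h => h
  · simp [IntExpr.eval]
  · rintro _ rfl
    exact key k 0 (by omega)
  · simp only [IntExpr.cost]
    omega

end

/-! ### Subtracting the seed from the line sums -/

section

variable {V : Type*}

/-- The width `m - a₀ - ⋯ - aᵢ₋₁` of the box left after the directions before `i`. -/
def width (m : ℕ) (dir : ℕ → ℤ × ℤ) (i : ℕ) : ℤ := m - ∑ h ∈ Finset.range i, (dir h).1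

/-- The height `n - |b₀| - ⋯ - |bᵢ₋₁|` of the box left after the directions before `i`. -/
def height (n : ℕ) (dir : ℕ → ℤ × ℤ) (i : ℕ) : ℤ := n - ∑ h ∈ Finset.range i, |(dir h).2|

/-- The integer arrays hold the directions (array `0`) and, for each of them, the sides of the
remaining box and the positive and negative parts of the second coordinate (array `1`). -/
structure Tables (m n d : ℕ) (dir : ℕ → ℤ × ℤ) (I : ℕ → ℤ × ℤ → ℤ) : Prop where
  fst : ∀ h : ℕ, I 0 (h, 0) = (dir h).1
  snd : ∀ h : ℕ, I 0 (h, 1) = (dir h).2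
  width : ∀ h ≤ d, I 1 (h, 0) = width m dir h
  height : ∀ h ≤ d, I 1 (h, 1) = height n dir h
  pos : ∀ h < d, I 1 (h, 2) = max (dir h).2 0
  neg : ∀ h < d, I 1 (h, 3) = max (-(dir h).2) 0

/-- The part of the memory that stays fixed after the preparations: register `4` holds the number
`k` of directions used for a reduction step, register `5` the number `K` of directions whose line
sums are followed. -/
structure Env (m n d k K : ℕ) (dir : ℕ → ℤ × ℤ) (s : State V) : Prop where
  reg0 : s.reg 0 = m
  reg1 : s.reg 1 = n
  reg2 : s.reg 2 = d
  reg4 : s.reg 4 = k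
  reg5 : s.reg 5 = K
  tables : Tables m n d dir s.intArr

/-- First coordinate of the `i`-th direction. -/
def fstE (i : IntExpr) : IntExpr := .get 0 i (.const 0)
/-- Second coordinate of the `i`-th direction. -/
def sndE (i : IntExpr) : IntExpr := .get 0 i (.const 1)
/-- Width of the box before the `i`-th direction. -/
def widthE (i : IntExpr) : IntExpr := .get 1 i (.const 0)
/-- Height of the box before the `i`-th direction. -/
def heightE (i : IntExpr) : IntExpr := .get 1 i (.const 1)
/-- Positive part of the second coordinate of the `i`-th direction. -/
def posE (i : IntExpr) : IntExpr := .get 1 i (.const 2)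
/-- Negative part of the second coordinate of the `i`-th direction. -/
def negE (i : IntExpr) : IntExpr := .get 1 i (.const 3)
/-- Number of the line through `(p, q)` in the `i`-th direction. -/
def indexE (i p q : IntExpr) : IntExpr := .sub (.mul (fstE i) q) (.mul (sndE i) p)
/-- The row `i d + j` of the value array `0`, for the line sums in direction `j` of the `i`-th
remainder. -/
def rowE (i j : IntExpr) : IntExpr := .add (.mul i (.reg 2)) j
/-- The row `2 m i + p` of the value array `1`, for the `p`-th column of the `i`-th partial solution.
The factor `2` leaves room for reading at columns from `-m` to `m`, where the solution vanishes. -/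
def outRowE (i p : IntExpr) : IntExpr := .add (.mul (.mul (.const 2) (.reg 0)) i) p

/-- The predecessor of `(p, q)` in the `i`-th direction lies in the box. -/
def interiorC (i p q : IntExpr) : Cond :=
  .and (.le (fstE i) p) (.and (.le (posE i) q) (.lt q (.sub (heightE i) (negE i))))

namespace Env

variable {m n d k K : ℕ} {dir : ℕ → ℤ × ℤ} {s s' : State V}

theorem of_keeps (h : Env m n d k K dir s) {r : ℕ} (hk : Keeps r s s') (hr : 6 ≤ r)
    (hI : s'.intArr = s.intArr) : Env m n d k K dir s' where
  reg0 := (hk 0 (by omega)).trans h.reg0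
  reg1 := (hk 1 (by omega)).trans h.reg1
  reg2 := (hk 2 (by omega)).trans h.reg2
  reg4 := (hk 4 (by omega)).trans h.reg4
  reg5 := (hk 5 (by omega)).trans h.reg5
  tables := hI ▸ h.tables

theorem eval_fstE (h : Env m n d k K dir s) {e : IntExpr} {i : ℕ} (he : e.eval s = i) :
    (fstE e).eval s = (dir i).1 := by
  simp [fstE, IntExpr.eval, he, h.tables.fst]

theorem eval_sndE (h : Env m n d k K dir s) {e : IntExpr} {i : ℕ} (he : e.eval s = i) :
    (sndE e).eval s = (dir i).2 := by
  simp [sndE, IntExpr.eval, he, h.tables.snd]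

theorem eval_widthE (h : Env m n d k K dir s) {e : IntExpr} {i : ℕ} (he : e.eval s = i)
    (hi : i ≤ d) : (widthE e).eval s = width m dir i := by
  simp [widthE, IntExpr.eval, he, h.tables.width i hi]

theorem eval_heightE (h : Env m n d k K dir s) {e : IntExpr} {i : ℕ} (he : e.eval s = i)
    (hi : i ≤ d) : (heightE e).eval s = height n dir i := by
  simp [heightE, IntExpr.eval, he, h.tables.height i hi]

theorem eval_posE (h : Env m n d k K dir s) {e : IntExpr} {i : ℕ} (he : e.eval s = i)
    (hi : i < d) : (posE e).eval s = max (dir i).2 0 := by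
  simp [posE, IntExpr.eval, he, h.tables.pos i hi]

theorem eval_negE (h : Env m n d k K dir s) {e : IntExpr} {i : ℕ} (he : e.eval s = i)
    (hi : i < d) : (negE e).eval s = max (-(dir i).2) 0 := by
  simp [negE, IntExpr.eval, he, h.tables.neg i hi]

theorem eval_indexE (h : Env m n d k K dir s) {e ep eq : IntExpr} {i : ℕ} {p q : ℤ}
    (he : e.eval s = i) (hp : ep.eval s = p) (hq : eq.eval s = q) :
    (indexE e ep eq).eval s = lineIndex (dir i) (p, q) := by
  simp [indexE, IntExpr.eval, h.eval_fstE he, h.eval_sndE he, hp, hq, lineIndex]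

theorem eval_rowE (h : Env m n d k K dir s) {e e' : IntExpr} {i j : ℤ}
    (he : e.eval s = i) (he' : e'.eval s = j) : (rowE e e').eval s = i * d + j := by
  simp [rowE, IntExpr.eval, he, he', h.reg2]

theorem holds_interiorC (h : Env m n d k K dir s) {e ep eq : IntExpr} {i p q M N : ℕ}
    (he : e.eval s = i) (hp : ep.eval s = p) (hq : eq.eval s = q) (hi : i < d)
    (hN : height n dir i = N) (ha : 0 ≤ (dir i).1) (hpM : p < M) (hqN : q < N) :
    (interiorC e ep eq).Holds s ↔ ((p : ℤ), (q : ℤ)) - dir i ∈ box M N := by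
  simp only [interiorC, Cond.Holds, Cond.holds_lt, IntExpr.eval, h.eval_fstE he, hp, hq,
    h.eval_posE he hi, h.eval_negE he hi, h.eval_heightE he hi.le, hN, mem_box, Prod.fst_sub,
    Prod.snd_sub]
  omega

theorem eval_outRowE (h : Env m n d k K dir s) {e e' : IntExpr} {i p : ℤ}
    (he : e.eval s = i) (he' : e'.eval s = p) : (outRowE e e').eval s = 2 * m * i + p := by
  simp [outRowE, IntExpr.eval, he, he', h.reg0]

end Env

theorem valArr_setVal (s : State V) (A : ℕ) (c c' : ℤ × ℤ) (x : V) :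
    (s.setVal A c x).valArr A c' = if c' = c then x else s.valArr A c' := by
  simp [State.setVal, Function.update_apply]

theorem valArr_setVal_of_ne (s : State V) {A A' : ℕ} (c : ℤ × ℤ) (x : V) (h : A' ≠ A) :
    (s.setVal A c x).valArr A' = s.valArr A' := by
  simp [State.setVal, h]

variable [AddCommGroup V]

/-- The rows `i d + j`, `i < j < K`, of the value array `0` are diminished by `δ j`. -/
structure RowsSub (i K d : ℕ) (W W' : ℕ → ℤ × ℤ → V) (δ : ℕ → ℤ → V) : Prop where
  sub : ∀ j, i < j → j < K → ∀ c, W' 0 (i * d + j, c) = W 0 (i * d + j, c) - δ j c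
  off : ∀ r c : ℤ, (∀ j : ℕ, i < j → j < K → r ≠ i * d + j) → W' 0 (r, c) = W 0 (r, c)
  other : ∀ A ≠ 0, W' A = W A

theorem RowsSub.refl (i K d : ℕ) (W : ℕ → ℤ × ℤ → V) : RowsSub i K d W W fun _ _ => 0 :=
  ⟨fun _ _ _ _ => by simp, fun _ _ _ => rfl, fun _ _ => rfl⟩

theorem RowsSub.trans {i K d : ℕ} {W W' W'' : ℕ → ℤ × ℤ → V} {δ δ' : ℕ → ℤ → V}
    (h : RowsSub i K d W W' δ) (h' : RowsSub i K d W' W'' δ') :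
    RowsSub i K d W W'' fun j c => δ j c + δ' j c :=
  ⟨fun j h1 h2 c => by rw [h'.sub j h1 h2, h.sub j h1 h2]; abel,
    fun r c hr => (h'.off r c hr).trans (h.off r c hr),
    fun A hA => (h'.other A hA).trans (h.other A hA)⟩

theorem RowsSub.congr {i K d : ℕ} {W W' : ℕ → ℤ × ℤ → V} {δ δ' : ℕ → ℤ → V}
    (h : RowsSub i K d W W' δ) (h' : ∀ j, i < j → j < K → ∀ c, δ j c = δ' j c) :
    RowsSub i K d W W' δ' :=
  ⟨fun j h1 h2 c => by rw [h.sub j h1 h2, h' j h1 h2], h.off, h.other⟩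

/-- The row of the direction that is being processed is not affected. -/
theorem RowsSub.diag {i K d : ℕ} {W W' : ℕ → ℤ × ℤ → V} {δ : ℕ → ℤ → V}
    (h : RowsSub i K d W W' δ) (c : ℤ) : W' 0 (i * d + i, c) = W 0 (i * d + i, c) :=
  h.off _ _ fun j h1 _ => by omega

/-- Subtract the entry of the seed at `(p, q)`, which is the line sum through that point, from the
line sums in all later directions. -/
def scatter : Program :=
  forLoop 9 (.add (.reg 6) (.const 1)) (.reg 5)
    (.setVal 0 (rowE (.reg 6) (.reg 9)) (indexE (.reg 9) (.reg 7) (.reg 8))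
      (.sub (.get 0 (rowE (.reg 6) (.reg 9)) (indexE (.reg 9) (.reg 7) (.reg 8)))
        (.get 0 (rowE (.reg 6) (.reg 6)) (indexE (.reg 6) (.reg 7) (.reg 8)))))

theorem runs_scatter {m n d k K : ℕ} {dir : ℕ → ℤ × ℤ} {s : State V}
    (h : Env m n d k K dir s) {i : ℕ} {p q : ℤ} (hi : s.reg 6 = i) (hp : s.reg 7 = p)
    (hq : s.reg 8 = q) (hiK : i < K) :
    Runs scatter s (100 * K) fun s' => (Keeps 9 s s' ∧ s'.intArr = s.intArr) ∧
      RowsSub i K d s.valArr s'.valArr fun j c => if lineIndex (dir j) (p, q) = c then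
        s.valArr 0 (i * d + i, lineIndex (dir i) (p, q)) else 0 := by
  refine (runs_forLoop (lo := i + 1) (hi := K) (B := fun _ => 69) (fun t W =>
    RowsSub i K d s.valArr W fun j c => if j < t ∧ lineIndex (dir j) (p, q) = c then
      s.valArr 0 (i * d + i, lineIndex (dir i) (p, q)) else 0) hiK (by simp [IntExpr.eval, hi])
    (fun s' hk _ => by simp [IntExpr.eval, hk 5 (by omega), h.reg5])
    ((RowsSub.refl i K d s.valArr).congr fun j h1 h2 c => (if_neg (by omega)).symm)
    fun j s₁ hj hjK hk hI hx hA => ?_).mono ?_ fun s' hs => ⟨hs.1, hs.2.congr fun j h1 h2 c => by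
      simp [h2]⟩
  · have h₁ := h.of_keeps hk (by omega) hI
    have e6 : (IntExpr.reg 6).eval s₁ = (i : ℤ) := (hk 6 (by omega)).trans hi
    have e7 : (IntExpr.reg 7).eval s₁ = p := (hk 7 (by omega)).trans hp
    have e8 : (IntExpr.reg 8).eval s₁ = q := (hk 8 (by omega)).trans hq
    have e9 : (IntExpr.reg 9).eval s₁ = (j : ℤ) := hx
    refine (Runs.setVal ?_).mono (by decide) fun s' hs => hs
    rw [ValExpr.eval, ValExpr.eval, ValExpr.eval, h₁.eval_rowE e6 e9, h₁.eval_rowE e6 e6,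
      h₁.eval_indexE e9 e7 e8, h₁.eval_indexE e6 e7 e8, hA.diag]
    refine ⟨⟨fun _ _ => rfl, rfl⟩, ⟨fun j' h1 h2 c => ?_, fun r c hr => ?_, fun A hA' => ?_⟩⟩
    · rw [valArr_setVal]
      by_cases hjj : j' = j
      · subst hjj
        by_cases hc : lineIndex (dir j') (p, q) = c
        · rw [if_pos (by rw [hc]), if_pos ⟨by omega, hc⟩, hA.sub j' h1 h2, if_neg (by omega), hc]
          simp
        · rw [if_neg (fun h => hc (by simpa using (congrArg Prod.snd h).symm)),
            if_neg (fun h => hc h.2), hA.sub j' h1 h2, if_neg (by omega)]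
      · rw [if_neg (fun h => by
            have := congrArg Prod.fst h
            simp only [add_right_inj, Nat.cast_inj] at this
            exact hjj this), hA.sub j' h1 h2]
        have : j' < j ↔ j' < j + 1 := by omega
        simp [this]
    · rw [valArr_setVal, if_neg (fun h => hr j (by omega) hjK (congrArg Prod.fst h)),
        hA.off r c hr]
    · rw [valArr_setVal_of_ne _ _ _ hA', hA.other A hA']
  · rw [Finset.sum_const, Nat.card_Ico, smul_eq_mul]
    simp only [IntExpr.cost]
    omega

/-- Subtract the contribution of the seed from the line sums in all later directions. Only the
points where the seed lives lead to a loop over the directions. -/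
def clear : Program :=
  forLoop 7 (.const 0) (widthE (.reg 6)) (forLoop 8 (.const 0) (heightE (.reg 6))
    (.ite (interiorC (.reg 6) (.reg 7) (.reg 8)) .skip scatter))

/-- The number of first points of lines is at most the number of points in `|a|` columns and `|b|`
rows. This is what keeps the total cost linear. -/
theorem sum_border_le {M N : ℕ} {v : ℤ × ℤ} (hv : 0 ≤ v.1) :
    ∑ p ∈ Finset.range M, ∑ q ∈ Finset.range N,
      (if ((p : ℤ), (q : ℤ)) - v ∈ box M N then 0 else 1) ≤ v.1.natAbs * N + v.2.natAbs * M := by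
  have h1 : ∀ p ∈ Finset.range M, ∑ q ∈ Finset.range N,
      (if ((p : ℤ), (q : ℤ)) - v ∈ box M N then 0 else 1) ≤
        (if p < v.1.natAbs then N else 0) + v.2.natAbs := by
    intro p hp
    rw [Finset.mem_range] at hp
    split_ifs with h
    · refine (Finset.sum_le_card_nsmul _ _ 1 fun q _ => by split_ifs <;> simp).trans ?_
      simp
    · rw [zero_add]
      have : ∀ q ∈ Finset.range N, (if ((p : ℤ), (q : ℤ)) - v ∈ box M N then 0 else 1) ≤
          if q ∈ (if 0 ≤ v.2 then Finset.Ico 0 v.2.natAbs else Finset.Ico (N - v.2.natAbs) N)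
            then 1 else 0 := by
        intro q hq
        rw [Finset.mem_range] at hq
        simp only [mem_box, Prod.fst_sub, Prod.snd_sub]
        split_ifs <;> simp_all <;> omega
      refine (Finset.sum_le_sum this).trans ?_
      rw [Finset.sum_ite_mem, Finset.sum_const, smul_eq_mul, mul_one]
      refine (Finset.card_le_card Finset.inter_subset_right).trans ?_
      split_ifs <;> simp only [Nat.card_Ico] <;> omega
  refine (Finset.sum_le_sum h1).trans ?_
  rw [Finset.sum_add_distrib, Finset.sum_const, Finset.card_range, smul_eq_mul, mul_comm M]
  refine Nat.add_le_add_right ?_ _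
  rw [← Finset.sum_filter, Finset.sum_const, smul_eq_mul]
  refine Nat.mul_le_mul_right _ ?_
  refine (Finset.card_le_card (t := Finset.range v.1.natAbs) fun p hp => ?_).trans (by simp)
  simpa using (Finset.mem_filter.mp hp).2

theorem runs_clear {m n d k K : ℕ} {dir : ℕ → ℤ × ℤ} {s : State V}
    (h : Env m n d k K dir s) {i M N : ℕ} (hi : s.reg 6 = i) (hiK : i < K) (hK : K ≤ d)
    (hM : width m dir i = M) (hN : height n dir i = N) (ha : 0 ≤ (dir i).1) :
    Runs clear s (100 * K * ((dir i).1.natAbs * N + (dir i).2.natAbs * M) +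
        (60 * N + 40) * M + 20) fun s' =>
      (Keeps 7 s s' ∧ s'.intArr = s.intArr) ∧
      RowsSub i K d s.valArr s'.valArr fun j c => ∑ p ∈ Finset.range M, ∑ q ∈ Finset.range N,
        if lineIndex (dir j) ((p : ℤ), (q : ℤ)) = c then
          seed M N (dir i) (fun c => s.valArr 0 (i * d + i, c)) ((p : ℤ), (q : ℤ)) else 0 := by
  set g := seed M N (dir i) (fun c => s.valArr 0 (i * d + i, c)) with hg
  let b : ℕ → ℕ → ℕ := fun p q => if ((p : ℤ), (q : ℤ)) - dir i ∈ box M N then 0 else 1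
  refine (runs_forLoop (lo := 0) (hi := M)
    (B := fun p => ∑ q ∈ Finset.range N, (100 * K * b p q + 50) + 20) (fun P W =>
    RowsSub i K d s.valArr W fun j c => ∑ p ∈ Finset.range P, ∑ q ∈ Finset.range N,
        if lineIndex (dir j) ((p : ℤ), (q : ℤ)) = c then g ((p : ℤ), (q : ℤ)) else 0)
    (Nat.zero_le _) (by simp [IntExpr.eval])
    (fun s' hk hI => ?_) (by simpa using RowsSub.refl i K d s.valArr)
    fun p s₁ _ hp hk hI hx hA => ?_).mono ?_ fun s' hs => hs
  · rw [(h.of_keeps hk (by omega) hI).eval_widthE (e := .reg 6) ((hk 6 (by omega)).trans hi) (by omega), hM]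
  · have h₁ := h.of_keeps hk (by omega) hI
    have hi₁ := (hk 6 (by omega)).trans hi
    refine (runs_forLoop (lo := 0) (hi := N) (B := fun q => 100 * K * b p q + 32) (fun Q W =>
      RowsSub i K d s₁.valArr W fun j c => ∑ q ∈ Finset.range Q,
        if lineIndex (dir j) ((p : ℤ), (q : ℤ)) = c then g ((p : ℤ), (q : ℤ)) else 0)
      (Nat.zero_le _) (by simp [IntExpr.eval])
      (fun s' hk' hI' => ?_) (by simpa using RowsSub.refl i K d s₁.valArr)
      fun q s₂ _ hq hk' hI' hx' hA' => ?_).mono ?_ fun s' hs => ⟨hs.1, (hA.trans hs.2).congr ?_⟩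
    · rw [(h₁.of_keeps hk' (by omega) hI').eval_heightE (e := .reg 6) ((hk' 6 (by omega)).trans hi₁)
        (by omega), hN]
    · have h₂ := h₁.of_keeps hk' (by omega) hI'
      have hi₂ : s₂.reg 6 = i := (hk' 6 (by omega)).trans hi₁
      have hx₂ : s₂.reg 7 = p := (hk' 7 (by omega)).trans hx
      have hint := h₂.holds_interiorC (e := .reg 6) (ep := .reg 7) (eq := .reg 8) hi₂ hx₂ hx'
        (by omega) hN ha hp hq
      have hmem : ((p : ℤ), (q : ℤ)) ∈ box M N := by simp [mem_box, hp, hq]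
      refine (Runs.ite (B := 100 * K * b p q + 1) (fun hc => ?_) fun hc => ?_).mono ?_
        fun s' hs => hs
      · rw [hint] at hc
        refine (Runs.skip ?_).mono (by omega) fun s' hs => hs
        refine ⟨⟨Keeps.refl _ _, rfl⟩, hA'.congr fun j h1 h2 c => ?_⟩
        have : g ((p : ℤ), (q : ℤ)) = 0 := if_neg fun h => h.2 hc
        simp [Finset.sum_range_succ, this]
      · rw [hint] at hc
        refine (runs_scatter h₂ hi₂ hx₂ hx' hiK).mono (by simp [b, hc]) fun s' hs => ?_
        refine ⟨hs.1, (hA'.trans hs.2).congr fun j h1 h2 c => ?_⟩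
        have : g ((p : ℤ), (q : ℤ)) = _ := if_pos ⟨hmem, hc⟩
        rw [Finset.sum_range_succ, hA'.diag, hA.diag, this]
      · simp only [interiorC, Cond.cost, Cond.lt, IntExpr.cost, fstE, posE, negE, heightE]
        omega
    · simp only [IntExpr.cost, heightE, ← Finset.range_eq_Ico]
      refine Nat.add_le_add (Finset.sum_le_sum fun q _ => by omega) (by omega)
    · intro j h1 h2 c
      simp only [Finset.sum_range_succ]
  · have hb : ∑ p ∈ Finset.range M, ∑ q ∈ Finset.range N, b p q ≤ _ := sum_border_le ha
    simp only [IntExpr.cost, widthE, ← Finset.range_eq_Ico]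
    have : ∑ p ∈ Finset.range M, (∑ q ∈ Finset.range N, (100 * K * b p q + 50) + 20 +
        (1 + 1 + 1 + 8)) = 100 * K * ∑ p ∈ Finset.range M, ∑ q ∈ Finset.range N, b p q +
        (50 * N + 31) * M := by
      simp only [Finset.sum_add_distrib, Finset.sum_const, Finset.card_range, smul_eq_mul,
        Finset.mul_sum]
      ring
    rw [this]
    have := Nat.mul_le_mul_left (100 * K) hb
    nlinarith

end

/-! ### Line sums of the next remainder in one direction -/

section

variable {V : Type*} [AddCommGroup V]

/-- The cell reached after `t` (register `11`) steps of a sweep. -/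
def sweepCellE : IntExpr := .add (.reg 9) (.mul (.reg 10) (.reg 11))
/-- The row of line sums, in the direction of register `7`, of the next remainder. -/
def nextRowE : IntExpr := rowE (.add (.reg 6) (.const 1)) (.reg 7)

/-- A sweep goes upwards from the smallest line number or downwards from the largest one, according
to the sign of the shift in register `8`. -/
def sweepStart : Program :=
  .ite (.lt (.const 0) (.reg 8))
    (.seq (.setReg 9 (.sub (.const 0) (.mul (posE (.reg 7)) (.reg 0)))) (.setReg 10 (.const 1)))
    (.seq (.setReg 9 (.add (.mul (fstE (.reg 7)) (.reg 1)) (.mul (negE (.reg 7)) (.reg 0))))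
      (.setReg 10 (.const (-1))))

/-- Solve the recurrence of `planeSum_eq_sub_planeSum_spread` from one end of a row to the other. -/
def sweepLoop : Program :=
  forLoop 11 (.const 0) (.add (.add (.mul (fstE (.reg 7)) (.reg 1))
      (.mul (.add (posE (.reg 7)) (negE (.reg 7))) (.reg 0))) (.const 1))
    (.setVal 0 nextRowE sweepCellE
      (.sub (.get 0 nextRowE (.sub sweepCellE (.reg 8)))
        (.get 0 (rowE (.reg 6) (.reg 7))
          (.add sweepCellE (.mul (fstE (.reg 7)) (negE (.reg 6)))))))

/-- Compute the line sums of `G` in one direction from those of `spread v G`. -/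
def sweepRow : Program :=
  .seq (.setReg 8 (.sub (.mul (fstE (.reg 7)) (sndE (.reg 6)))
    (.mul (sndE (.reg 7)) (fstE (.reg 6))))) (.seq sweepStart sweepLoop)

/-- `W'` differs from `W` only in the row `r` of the array `0`, where it equals `L`. -/
structure RowSet (r : ℤ) (W W' : ℕ → ℤ × ℤ → V) (L : ℤ → V) : Prop where
  row : ∀ c, W' 0 (r, c) = L c
  off : ∀ r' c : ℤ, r' ≠ r → W' 0 (r', c) = W 0 (r', c)
  other : ∀ A ≠ 0, W' A = W A

/-- After `t` steps the cells visited so far hold the final values. The others are still zero, and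
those from which the next step reads are zero in `L` too, or have been visited. -/
theorem runs_sweepLoop {m n d k K : ℕ} {dir : ℕ → ℤ × ℤ} {s : State V}
    (h : Env m n d k K dir s) {i j : ℕ} (hi : s.reg 6 = i) (hj : s.reg 7 = j) (hid : i < d)
    (hjd : j < d) {σ start δ : ℤ} (hσ : σ = 1 ∨ σ = -1) (h8 : s.reg 8 = δ)
    (h9 : s.reg 9 = start) (h10 : s.reg 10 = σ) (hδ : 0 < σ * δ) {w : ℕ}
    (hw : (dir j).1 * n + (max (dir j).2 0 + max (-(dir j).2) 0) * m + 1 = w) {L S : ℤ → V}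
    (hL : ∀ c, σ * (c - start) < 0 ∨ w ≤ σ * (c - start) → L c = 0)
    (hS : ∀ c, s.valArr 0 (i * d + j, c) = S c)
    (hLS : ∀ c, L c = L (c - δ) - S (c + (dir j).1 * max (-(dir i).2) 0))
    (h0 : ∀ c, s.valArr 0 ((i + 1) * d + j, c) = 0) :
    Runs sweepLoop s (100 * w + 30) fun s' => (Keeps 8 s s' ∧ s'.intArr = s.intArr) ∧
      RowSet ((i + 1) * d + j) s.valArr s'.valArr L := by
  refine (runs_forLoop (lo := 0) (hi := w) (B := fun _ => 50) (fun t W =>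
    RowSet ((i + 1) * d + j) s.valArr W fun c => if σ * (c - start) < t then L c else 0)
    (Nat.zero_le _) (by simp [IntExpr.eval]) (fun s' hk hI => ?_)
    ⟨fun c => ?_, fun _ _ _ => rfl, fun _ _ => rfl⟩
    fun t s₁ _ htw hk hI hx hA => ?_).mono ?_
    fun s' hs => ⟨⟨hs.1.1.mono (by omega), hs.1.2⟩, fun c => ?_, hs.2.off, hs.2.other⟩
  · have h₁ := h.of_keeps hk (by omega) hI
    have hj₁ : (IntExpr.reg 7).eval s' = j := (hk 7 (by omega)).trans hj
    simp only [IntExpr.eval]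
    rw [h₁.eval_fstE hj₁, h₁.eval_posE hj₁ hjd, h₁.eval_negE hj₁ hjd, h₁.reg0, h₁.reg1, hw]
  · rw [h0]
    split_ifs with hc
    · exact (hL c (Or.inl (by simpa using hc))).symm
    · rfl
  · have h₁ := h.of_keeps hk (by omega) hI
    have hi₁ : (IntExpr.reg 6).eval s₁ = i := (hk 6 (by omega)).trans hi
    have hj₁ : (IntExpr.reg 7).eval s₁ = j := (hk 7 (by omega)).trans hj
    have hi₂ : (IntExpr.add (.reg 6) (.const 1)).eval s₁ = (i : ℤ) + 1 := by
      simp [IntExpr.eval] at hi₁ ⊢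
      exact hi₁
    have hcell : sweepCellE.eval s₁ = start + σ * t := by
      simp [sweepCellE, IntExpr.eval, hk 9 (by omega), hk 10 (by omega), h9, h10, hx]
    have h8₁ : (IntExpr.reg 8).eval s₁ = δ := (hk 8 (by omega)).trans h8
    have hcell' : (IntExpr.sub sweepCellE (.reg 8)).eval s₁ = start + σ * t - δ := by
      rw [IntExpr.eval, hcell, h8₁]
    have hcell'' : (IntExpr.add sweepCellE (.mul (fstE (.reg 7)) (negE (.reg 6)))).eval s₁ =
        start + σ * t + (dir j).1 * max (-(dir i).2) 0 := by
      rw [IntExpr.eval, hcell, IntExpr.eval, h₁.eval_fstE hj₁, h₁.eval_negE hi₁ hid]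
    refine (Runs.setVal ?_).mono (by decide) fun s' hs => hs
    rw [ValExpr.eval, ValExpr.eval, ValExpr.eval, nextRowE, h₁.eval_rowE hi₂ hj₁, hcell, hcell',
      hcell'', h₁.eval_rowE hi₁ hj₁, hA.row, hA.off _ _ (by nlinarith), hS]
    have hval : (if σ * (start + σ * t - δ - start) < t then L (start + σ * t - δ) else 0) -
        S (start + σ * t + (dir j).1 * max (-(dir i).2) 0) = L (start + σ * t) := by
      rw [if_pos, ← hLS]
      rcases hσ with rfl | rfl <;> linarith
    rw [hval]
    refine ⟨⟨fun _ _ => rfl, rfl⟩, fun c => ?_, fun r c hr => ?_, fun A hA' => ?_⟩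
    · rw [valArr_setVal]
      have e1 : c = start + σ * t ↔ σ * (c - start) = t := by
        rcases hσ with rfl | rfl <;> constructor <;> intro h <;> linarith
      by_cases hc : c = start + σ * t
      · rw [if_pos (by rw [hc]), if_pos (by rw [e1.mp hc]; push_cast; omega), hc]
      · rw [if_neg (fun h => hc (congrArg Prod.snd h)), hA.row]
        have e2 : σ * (c - start) < (t : ℤ) ↔ σ * (c - start) < ((t + 1 : ℕ) : ℤ) := by
          rw [e1] at hc
          push_cast
          omega
        simp only [e2]
    · rw [valArr_setVal, if_neg (fun h => hr (congrArg Prod.fst h)), hA.off r c hr]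
    · rw [valArr_setVal_of_ne _ _ _ hA', hA.other A hA']
  · simp only [IntExpr.cost, Finset.sum_const, Nat.card_Ico, smul_eq_mul, fstE, posE, negE]
    omega
  · rw [hs.2.row]
    split_ifs with hc
    · rfl
    · exact (hL c (Or.inr (by omega))).symm

theorem runs_sweepRow {m n d k K : ℕ} {dir : ℕ → ℤ × ℤ} {s : State V}
    (h : Env m n d k K dir s) {i j : ℕ} (hi : s.reg 6 = i) (hj : s.reg 7 = j) (hid : i < d)
    (hjd : j < d) (hdi : IsDirection (dir i)) (hdj : IsDirection (dir j)) (hne : dir i ≠ dir j)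
    {G : ℤ × ℤ → V} {M N : ℤ} (hG : G.support ⊆ box M N) (hM : M ≤ m) (hN : N ≤ n)
    (hS : ∀ c, s.valArr 0 (i * d + j, c) = planeSum (dir j) (spread (dir i) G) c)
    (h0 : ∀ c, s.valArr 0 ((i + 1) * d + j, c) = 0) :
    Runs sweepRow s (100 * ((dir j).1.natAbs * n + (dir j).2.natAbs * m + 1) + 100) fun s' =>
      (Keeps 8 s s' ∧ s'.intArr = s.intArr) ∧
      RowSet ((i + 1) * d + j) s.valArr s'.valArr (planeSum (dir j) G) := by
  have hGf := finite_support_of_subset_box hG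
  set u := dir j with hu
  set v := dir i with hv
  set δ := u.1 * v.2 - u.2 * v.1 with hδ
  have hδ0 : δ ≠ 0 := hdj.det_ne_zero hdi hne.symm
  have hw : u.1 * n + (max u.2 0 + max (-u.2) 0) * m + 1 =
      ((u.1.natAbs * n + u.2.natAbs * m + 1 : ℕ) : ℤ) := by
    have h1 : max u.2 0 + max (-u.2) 0 = |u.2| := by
      rcases abs_cases u.2 with h | h <;> omega
    push_cast
    rw [h1, abs_of_nonneg hdj.fst_nonneg]
  have hi' : (IntExpr.reg 6).eval s = i := hi
  have hj' : (IntExpr.reg 7).eval s = j := hj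
  refine (Runs.seq (R := fun s' => s' = s.setReg 8 δ) (Runs.setReg ?_) fun s₀ hs₀ =>
    (Runs.seq (B' := 100 * (u.1.natAbs * n + u.2.natAbs * m + 1) + 30) (R := fun s' => ∃ σ start : ℤ, (σ = 1 ∨ σ = -1) ∧ 0 < σ * δ ∧
      (σ = 1 → start = -(max u.2 0 * m)) ∧
      (σ = -1 → start = u.1 * n + max (-u.2) 0 * m) ∧ Keeps 8 s s' ∧ s'.intArr = s.intArr ∧
      s'.valArr = s.valArr ∧ s'.reg 8 = δ ∧ s'.reg 9 = start ∧ s'.reg 10 = σ) (B := 40)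
      ?_ ?_)).mono ?_ fun s' hs => hs
  · rw [IntExpr.eval, IntExpr.eval, IntExpr.eval, h.eval_fstE hj', h.eval_sndE hi',
      h.eval_fstE hi', h.eval_sndE hj']
  · subst hs₀
    have hk₀ : Keeps 8 s (s.setReg 8 δ) := Keeps.setReg _ _ le_rfl
    have h₀ := h.of_keeps hk₀ (by omega) rfl
    have hj₀ : (IntExpr.reg 7).eval (s.setReg 8 δ) = j := hj
    have hcond : (Cond.lt (.const 0) (.reg 8)).Holds (s.setReg 8 δ) ↔ 0 < δ := by
      simp [Cond.holds_lt, IntExpr.eval, State.setReg]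
    refine (Runs.ite (B := 20) (fun hc => ?_) fun hc => ?_).mono (by decide) fun s' hs => hs
    · rw [hcond] at hc
      refine (Runs.seq (R := fun s' => s' = (s.setReg 8 δ).setReg 9 (-(max u.2 0 * m)))
        (Runs.setReg ?_) fun s₁ hs₁ => Runs.setReg ?_).mono (by decide) fun s' hs => hs
      · rw [IntExpr.eval, IntExpr.eval, IntExpr.eval, IntExpr.eval, h₀.eval_posE hj₀ hjd, h₀.reg0,
          zero_sub]
      · subst hs₁
        refine ⟨1, _, Or.inl rfl, by omega, fun _ => rfl, fun h => by omega, ?_, rfl, rfl, ?_, ?_, ?_⟩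
        · exact (hk₀.trans (Keeps.setReg _ _ (by omega))).trans (Keeps.setReg _ _ (by omega))
        all_goals simp [State.setReg, IntExpr.eval]
    · rw [hcond] at hc
      refine (Runs.seq (R := fun s' => s' = (s.setReg 8 δ).setReg 9
          (u.1 * n + max (-u.2) 0 * m))
        (Runs.setReg ?_) fun s₁ hs₁ => Runs.setReg ?_).mono (by decide) fun s' hs => hs
      · rw [IntExpr.eval, IntExpr.eval, IntExpr.eval, IntExpr.eval, IntExpr.eval,
          h₀.eval_negE hj₀ hjd, h₀.eval_fstE hj₀, h₀.reg0, h₀.reg1]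
      · subst hs₁
        refine ⟨-1, _, Or.inr rfl, by omega, fun h => by omega, fun _ => rfl, ?_, rfl, rfl, ?_, ?_, ?_⟩
        · exact (hk₀.trans (Keeps.setReg _ _ (by omega))).trans (Keeps.setReg _ _ (by omega))
        all_goals simp [State.setReg, IntExpr.eval]
  · rintro s₁ ⟨σ, start, hσ, hσδ, hs1, hs2, hk, hI, hW, h8, h9, h10⟩
    have h₁ := h.of_keeps hk (by omega) hI
    refine (runs_sweepLoop h₁ ((hk 6 (by omega)).trans hi) ((hk 7 (by omega)).trans hj) hid hjd
      hσ h8 h9 h10 hσδ hw (L := planeSum u G) (S := planeSum u (spread v G))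
      (fun c hc => ?_) (fun c => by rw [hW]; exact hS c)
      (fun c => ?_) (fun c => by rw [hW]; exact h0 c)).mono le_rfl
      fun s' hs => ⟨⟨hk.trans hs.1.1, hs.1.2.trans hI⟩, hW ▸ hs.2⟩
    · apply planeSum_eq_zero_of_notMem hdj hG hM hN
      rw [← hw] at hc
      rcases hσ with rfl | rfl
      · rw [hs1 rfl, add_mul] at hc
        rcases hc with hc | hc
        · left; linarith
        · right; linarith
      · rw [hs2 rfl, add_mul] at hc
        rcases hc with hc | hc
        · right; linarith
        · left; linarith
    · exact planeSum_eq_sub_planeSum_spread hGf u v c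
  · simp only [IntExpr.cost, fstE, sndE]
    omega

end

/-! ### The sequence of remainders -/

section

variable {V : Type*} [AddCommGroup V]

/-- Newton interpolation: `F (i + 1)` is the remainder left of `F i` when its line sums in the
direction `i` have been accounted for by a seed. -/
structure Decomposes (m n d : ℕ) (dir : ℕ → ℤ × ℤ) (F : ℕ → ℤ × ℤ → V) : Prop where
  support_subset : ∀ i, (F i).support ⊆ box (width m dir i) (height n dir i)
  eq_add : ∀ i < d, F i = fun x => seed (width m dir i) (height n dir i) (dir i)
    (planeSum (dir i) (F i)) x + spread (dir i) (F (i + 1)) x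

theorem width_succ (m : ℕ) (dir : ℕ → ℤ × ℤ) (i : ℕ) :
    width m dir (i + 1) = width m dir i - (dir i).1 := by
  rw [width, width, Finset.sum_range_succ]
  ring

theorem height_succ (n : ℕ) (dir : ℕ → ℤ × ℤ) (i : ℕ) :
    height n dir (i + 1) = height n dir i - |(dir i).2| := by
  rw [height, height, Finset.sum_range_succ]
  ring

theorem exists_decomposes {m n d : ℕ} {dir : ℕ → ℤ × ℤ} (hdir : ∀ i < d, IsDirection (dir i))
    {f : ℤ × ℤ → V} (hf : f.support ⊆ box m n) :
    ∃ F : ℕ → ℤ × ℤ → V, F 0 = f ∧ Decomposes m n d dir F := by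
  have step : ∀ i, ∀ G : {G : ℤ × ℤ → V // G.support ⊆ box (width m dir i) (height n dir i)},
      ∃ G' : {G : ℤ × ℤ → V // G.support ⊆ box (width m dir (i + 1)) (height n dir (i + 1))},
      i < d → G.1 = fun x => seed (width m dir i) (height n dir i) (dir i)
        (planeSum (dir i) G.1) x + spread (dir i) G'.1 x := by
    intro i G
    by_cases hi : i < d
    · have hG := finite_support_of_subset_box G.2
      have hs := support_seed_subset (width m dir i) (height n dir i) (dir i)
        (planeSum (dir i) G.1)
      have hsub : (fun x => G.1 x - seed (width m dir i) (height n dir i) (dir i)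
          (planeSum (dir i) G.1) x).support ⊆ box (width m dir i) (height n dir i) :=
        (Function.support_sub _ _).trans (Set.union_subset G.2 hs)
      obtain ⟨G', h1, h2⟩ := exists_eq_spread (hdir i hi) hsub fun c => by
        rw [planeSum_sub hG (finite_support_of_subset_box hs), planeSum_seed (hdir i hi) G.2,
          sub_self]
      refine ⟨⟨G', by rwa [width_succ, height_succ]⟩, fun _ => ?_⟩
      rw [← h2]
      simp
    · exact ⟨⟨0, by simp⟩, fun h => absurd h hi⟩
  choose next hnext using step
  let F : ∀ i, {G : ℤ × ℤ → V // G.support ⊆ box (width m dir i) (height n dir i)} :=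
    fun i => Nat.rec ⟨f, by simpa [width, height] using hf⟩ (fun i G => next i G) i
  exact ⟨fun i => (F i).1, rfl, fun i => (F i).2, fun i hi => hnext i (F i) hi⟩

theorem Decomposes.planeSum_spread_eq {m n d : ℕ} {dir : ℕ → ℤ × ℤ} {F : ℕ → ℤ × ℤ → V}
    (h : Decomposes m n d dir F) {i : ℕ} (hi : i < d) (u : ℤ × ℤ) (c : ℤ) :
    planeSum u (spread (dir i) (F (i + 1))) c = planeSum u (F i) c -
      planeSum u (seed (width m dir i) (height n dir i) (dir i) (planeSum (dir i) (F i))) c := by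
  have hs := support_seed_subset (width m dir i) (height n dir i) (dir i)
    (planeSum (dir i) (F i))
  have : planeSum u (F i) c = planeSum u (seed (width m dir i) (height n dir i) (dir i)
      (planeSum (dir i) (F i))) c + planeSum u (spread (dir i) (F (i + 1))) c := by
    rw [← planeSum_add (finite_support_of_subset_box hs)
      (finite_support_spread (finite_support_of_subset_box (h.support_subset _)) _), ← h.eq_add i hi]
  rw [this]
  abel

/-- Compute the line sums of the next remainder in all later directions. -/
def sweep : Program := forLoop 7 (.add (.reg 6) (.const 1)) (.reg 5) sweepRow

/-- Compute the line sums of all remainders. -/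
def forward : Program := forLoop 6 (.const 0) (.reg 4) (.seq clear sweep)

/-- The quantity `|a| n + |b| m` by which the work for one direction is measured: it bounds the size
of a seed, and a sweep over a row of line sums visits one cell more. -/
def weight (m n : ℕ) (v : ℤ × ℤ) : ℕ := v.1.natAbs * n + v.2.natAbs * m

theorem runs_sweep {m n d k K : ℕ} {dir : ℕ → ℤ × ℤ} {s : State V}
    (h : Env m n d k K dir s) {i : ℕ} (hi : s.reg 6 = i) (hiK : i < K) (hK : K ≤ d)
    (hdir : ∀ j < d, IsDirection (dir j)) (hinj : ∀ j < d, i ≠ j → dir i ≠ dir j)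
    {G : ℤ × ℤ → V} {M N : ℤ} (hG : G.support ⊆ box M N) (hM : M ≤ m) (hN : N ≤ n)
    (hS : ∀ j, i < j → j < K → ∀ c, s.valArr 0 (i * d + j, c) =
      planeSum (dir j) (spread (dir i) G) c)
    (h0 : ∀ r c : ℤ, (i + 1) * d ≤ r → s.valArr 0 (r, c) = 0) :
    Runs sweep s (∑ j ∈ Finset.range K, 210 * (weight m n (dir j) + 1) + 20) fun s' =>
      (Keeps 7 s s' ∧ s'.intArr = s.intArr) ∧
      (∀ j, i < j → j < K → ∀ c, s'.valArr 0 ((i + 1) * d + j, c) = planeSum (dir j) G c) ∧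
      (∀ r c : ℤ, (∀ j : ℕ, i < j → j < K → r ≠ (i + 1) * d + j) →
        s'.valArr 0 (r, c) = s.valArr 0 (r, c)) ∧ ∀ A ≠ 0, s'.valArr A = s.valArr A := by
  refine (runs_forLoop (lo := i + 1) (hi := K)
    (B := fun j => 100 * (weight m n (dir j) + 1) + 100) (fun t W =>
      (∀ j, i < j → j < t → ∀ c, W 0 ((i + 1) * d + j, c) = planeSum (dir j) G c) ∧
      (∀ r c : ℤ, (∀ j : ℕ, i < j → j < t → r ≠ (i + 1) * d + j) →
        W 0 (r, c) = s.valArr 0 (r, c)) ∧ ∀ A ≠ 0, W A = s.valArr A)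
    hiK (by simp [IntExpr.eval, hi]) (fun s' hk _ => by simp [IntExpr.eval, hk 5 (by omega), h.reg5])
    ⟨fun j _ _ => by omega, fun _ _ _ => rfl, fun _ _ => rfl⟩
    fun j s₁ hj hjK hk hI hx hA => ?_).mono ?_ fun s' hs => hs
  · have h₁ := h.of_keeps hk (by omega) hI
    refine (runs_sweepRow h₁ ((hk 6 (by omega)).trans hi) hx (by omega) (by omega)
      (hdir i (by omega)) (hdir j (by omega)) (hinj j (by omega) (by omega)) hG hM hN
      (fun c => ?_) fun c => ?_).mono le_rfl fun s' hs => ⟨hs.1, fun j' h1 h2 c => ?_,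
        fun r c hr => ?_, fun A hA' => ?_⟩
    · rw [hA.2.1 _ _ fun j' _ _ => by nlinarith, hS j (by omega) hjK]
    · rw [hA.2.1 _ _ fun j' _ _ => by omega, h0 _ _ (by omega)]
    · by_cases hjj : j' = j
      · subst hjj
        exact hs.2.row c
      · rw [hs.2.off _ _ (by omega), hA.1 j' h1 (by omega)]
    · rw [hs.2.off r c (hr j (by omega) (by omega)),
        hA.2.1 r c fun j' h1 h2 => hr j' h1 (by omega)]
    · rw [hs.2.other A hA', hA.2.2 A hA']
  · simp only [IntExpr.cost]
    refine Nat.add_le_add ?_ (by omega)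
    refine (Finset.sum_le_sum_of_subset (t := Finset.range K) fun j hj => ?_).trans
      (Finset.sum_le_sum fun j _ => by omega)
    simp only [Finset.mem_Ico, Finset.mem_range] at hj ⊢
    omega

theorem width_le {m d : ℕ} {dir : ℕ → ℤ × ℤ} (hdir : ∀ j < d, IsDirection (dir j)) {i : ℕ}
    (hi : i ≤ d) : width m dir i ≤ m := by
  have : 0 ≤ ∑ h ∈ Finset.range i, (dir h).1 :=
    Finset.sum_nonneg fun j hj => (hdir j ((Finset.mem_range.mp hj).trans_le hi)).fst_nonneg
  rw [width]
  omega

theorem height_le (n : ℕ) (dir : ℕ → ℤ × ℤ) (i : ℕ) : height n dir i ≤ n := by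
  have : 0 ≤ ∑ h ∈ Finset.range i, |(dir h).2| := Finset.sum_nonneg fun j hj => abs_nonneg _
  rw [height]
  omega

/-- When round `i` begins, row `i d + j` holds the line sums of `F i` in direction `j ≥ i`, the rows
`i' d + i'` with `i' < i` hold what the seeds need, and all later rows are untouched. -/
theorem runs_forward {m n d k K : ℕ} {dir : ℕ → ℤ × ℤ} {s : State V}
    (h : Env m n d k K dir s) (hm : 0 < m) (hn : 0 < n) (hkd : k ≤ d) (hkK : k ≤ K) (hK : K ≤ d)
    (hdir : ∀ j < d, IsDirection (dir j)) (hinj : ∀ i < d, ∀ j < d, i ≠ j → dir i ≠ dir j)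
    (hM : ∀ i ≤ k, 0 < width m dir i) (hN : ∀ i ≤ k, 0 < height n dir i)
    {F : ℕ → ℤ × ℤ → V} (hF : Decomposes m n d dir F)
    (h0 : ∀ j < K, ∀ c : ℤ, s.valArr 0 (j, c) = planeSum (dir j) (F 0) c)
    (h0' : ∀ r c : ℤ, d ≤ r → s.valArr 0 (r, c) = 0) :
    Runs forward s (∑ i ∈ Finset.range k, (100 * K * weight m n (dir i) + 120 * (m * n) +
        ∑ j ∈ Finset.range K, 210 * (weight m n (dir j) + 1) + 30) + 10) fun s' =>
      (Keeps 6 s s' ∧ s'.intArr = s.intArr) ∧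
      (∀ i ≤ k, i < K → ∀ c, s'.valArr 0 (i * d + i, c) = planeSum (dir i) (F i) c) ∧
      ∀ A ≠ 0, s'.valArr A = s.valArr A := by
  refine (runs_forLoop (lo := 0) (hi := k) (B := fun i => 100 * K * weight m n (dir i) +
      120 * (m * n) + ∑ j ∈ Finset.range K, 210 * (weight m n (dir j) + 1) + 20) (fun i W =>
      (∀ i' ≤ i, i' < K → ∀ c, W 0 (i' * d + i', c) = planeSum (dir i') (F i') c) ∧
      (∀ j, i ≤ j → j < K → ∀ c, W 0 (i * d + j, c) = planeSum (dir j) (F i) c) ∧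
      (∀ r c : ℤ, (i + 1) * d ≤ r → W 0 (r, c) = 0) ∧ ∀ A ≠ 0, W A = s.valArr A)
    (Nat.zero_le _) (by simp [IntExpr.eval])
    (fun s' hk _ => by simp [IntExpr.eval, hk 4 (by omega), h.reg4])
    ⟨fun i hi hi' c => ?_, fun j _ hj c => by simpa using h0 j hj c,
      fun r c hr => h0' r c (by simpa using hr), fun _ _ => rfl⟩
    fun i s₁ _ hik hk hI hx hA => ?_).mono ?_ fun s' hs => ⟨hs.1, hs.2.1, hs.2.2.2.2⟩
  · obtain rfl : i = 0 := by omega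
    simpa using h0 0 hi' c
  · have h₁ := h.of_keeps hk (by omega) hI
    obtain ⟨M, hM'⟩ : ∃ M : ℕ, width m dir i = M :=
      ⟨_, (Int.toNat_of_nonneg (hM i hik.le).le).symm⟩
    obtain ⟨N, hN'⟩ : ∃ N : ℕ, height n dir i = N :=
      ⟨_, (Int.toNat_of_nonneg (hN i hik.le).le).symm⟩
    have hMm : M ≤ m := by
      have := width_le (m := m) hdir (hik.le.trans hkd)
      omega
    have hNn : N ≤ n := by
      have := height_le n dir i
      omega
    have hid : i < d := by omega
    have hdi := hdir i hid
    refine (Runs.seq (runs_clear h₁ hx (by omega) hK hM' hN' hdi.fst_nonneg)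
      (B' := ∑ j ∈ Finset.range K, 210 * (weight m n (dir j) + 1) + 20) fun s₂ hs₂ => ?_).mono ?_
      fun s' hs => hs
    · obtain ⟨⟨hk₂, hI₂⟩, hW₂⟩ := hs₂
      have hdiag : (fun c => s₁.valArr 0 (i * d + i, c)) = planeSum (dir i) (F i) :=
        funext fun c => hA.2.1 i le_rfl (by omega) c
      refine (runs_sweep (h₁.of_keeps hk₂ (by omega) hI₂) ((hk₂ 6 (by omega)).trans hx)
        (by omega) hK hdir (hinj i hid) (hF.support_subset (i + 1))
        (width_le hdir (by omega)) (height_le n dir _) (fun j hij hjK c => ?_)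
        fun r c hr => ?_).mono le_rfl fun s₃ hs₃ => ?_
      · rw [hW₂.sub j hij hjK, hA.2.1 j (by omega) hjK, hF.planeSum_spread_eq hid, hM', hN',
          planeSum_eq_sum (support_seed_subset _ _ _ _), hdiag]
      · rw [hW₂.off _ _ fun j _ _ => by nlinarith, hA.2.2.1 r c hr]
      · obtain ⟨⟨hk₃, hI₃⟩, hrow, hoff, hother⟩ := hs₃
        refine ⟨⟨hk₂.trans hk₃, hI₃.trans hI₂⟩, fun i' hi' hi'K c => ?_, fun j hj hjK c => ?_,
          fun r c hr => ?_, fun A hA' => ?_⟩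
        · by_cases hii : i' = i + 1
          · subst hii
            have := hrow (i + 1) (by omega) hi'K c
            push_cast
            exact this
          · have hle' : (i' : ℤ) * d ≤ i * d := by
              have : i' ≤ i := by omega
              gcongr
            have hle : (i' : ℤ) * d + i' < (i + 1) * d := by
              have : i' ≤ i := by omega
              nlinarith
            rw [hoff _ _ fun j _ _ => by omega]
            rw [hW₂.off _ _ fun j _ _ => by omega]
            exact hA.1 i' (by omega) hi'K c
        · push_cast
          exact hrow j (by omega) hjK c
        · push_cast at hr
          rw [hoff _ _ fun j _ _ => by nlinarith, hW₂.off _ _ fun j _ _ => by nlinarith,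
            hA.2.2.1 r c (by nlinarith)]
        · rw [hother A hA', hW₂.other A hA', hA.2.2.2 A hA']
    · have h1 : M * N ≤ m * n := Nat.mul_le_mul hMm hNn
      have h2 : m ≤ m * n := Nat.le_mul_of_pos_right m hn
      have h3 : (dir i).1.natAbs * N + (dir i).2.natAbs * M ≤ weight m n (dir i) :=
        Nat.add_le_add (Nat.mul_le_mul_left _ hNn) (Nat.mul_le_mul_left _ hMm)
      have h4 := Nat.mul_le_mul_left (100 * K) h3
      have h5 : 0 < m * n := Nat.mul_pos hm hn
      nlinarith
  · simp only [IntExpr.cost, ← Finset.range_eq_Ico]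
    exact Nat.add_le_add (Finset.sum_le_sum fun i _ => by omega) (by omega)

end

/-! ### Assembling the solution -/

section

variable {V : Type*} [AddCommGroup V]

/-- Run through the points `(p, q)` of a box, with `p` in register `x` and `q` in register `x + 1`. -/
def fill (x : ℕ) (e e' : IntExpr) (body : Program) : Program :=
  forLoop x (.const 0) e (forLoop (x + 1) (.const 0) e' body)

/-- If the body stores `G (p, q)` in the cell `(base + p, q)` of the value array `1`, then `G` is
stored on the whole box. The body may rely on all cells to the right of the box being unchanged. -/
theorem runs_fill {x : ℕ} {e e' : IntExpr} {body : Program} {s : State V} {M N B : ℕ} {base : ℤ}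
    {G : ℤ × ℤ → V} (he : ∀ s', Keeps x s s' → s'.intArr = s.intArr → e.eval s' = M)
    (he' : ∀ s', Keeps x s s' → s'.intArr = s.intArr → e'.eval s' = N)
    (hbody : ∀ p < M, ∀ q < N, ∀ s₁ : State V, Keeps x s s₁ → s₁.intArr = s.intArr →
      s₁.reg x = p → s₁.reg (x + 1) = q → (∀ A ≠ 1, s₁.valArr A = s.valArr A) →
      (∀ r c : ℤ, base + M ≤ r → s₁.valArr 1 (r, c) = s.valArr 1 (r, c)) →
      Runs body s₁ B fun s' => s' = s₁.setVal 1 (base + p, (q : ℤ)) (G (p, q))) :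
    Runs (fill x e e' body) s (((B + e'.cost + 8) * N + e.cost + e'.cost + 14) * M + e.cost + 6)
      fun s' => (Keeps x s s' ∧ s'.intArr = s.intArr) ∧ (∀ A ≠ 1, s'.valArr A = s.valArr A) ∧
      ∀ p q : ℤ, s'.valArr 1 (base + p, q) =
        if (p, q) ∈ box M N then G (p, q) else s.valArr 1 (base + p, q) := by
  refine (runs_forLoop (lo := 0) (hi := M) (B := fun _ => (B + e'.cost + 8) * N + e'.cost + 6)
    (fun P W => (∀ A ≠ 1, W A = s.valArr A) ∧ ∀ p q : ℤ, W 1 (base + p, q) =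
      if (p, q) ∈ box P N then G (p, q) else s.valArr 1 (base + p, q))
    (Nat.zero_le _) (by simp [IntExpr.eval]) he
    ⟨fun _ _ => rfl, fun p q => (if_neg (by simp only [mem_box]; omega)).symm⟩
    fun p s₁ _ hp hk hI hx hA => ?_).mono ?_ fun s' hs => hs
  · refine (runs_forLoop (lo := 0) (hi := N) (B := fun _ => B)
      (fun Q W => (∀ A ≠ 1, W A = s.valArr A) ∧ ∀ p' q' : ℤ, W 1 (base + p', q') =
        if (p', q') ∈ box p N ∨ (p' = p ∧ 0 ≤ q' ∧ q' < Q) then G (p', q')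
        else s.valArr 1 (base + p', q'))
      (Nat.zero_le _) (by simp [IntExpr.eval])
      (fun s' hk' hI' => he' s' (hk.trans (hk'.mono (by omega))) (hI'.trans hI))
      ⟨hA.1, fun p' q' => ?_⟩ fun q s₂ _ hq hk' hI' hx' hA' => ?_).mono ?_
      fun s' hs => ⟨hs.1, hs.2.1, fun p' q' => ?_⟩
    · rw [hA.2]
      refine if_congr ?_ rfl rfl
      simp only [Nat.cast_zero]
      constructor
      · exact Or.inl
      · rintro (h | h)
        · exact h
        · omega
    · refine (hbody p hp q hq s₂ (hk.trans (hk'.mono (by omega))) (hI'.trans hI)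
        ((hk' x (by omega)).trans hx) hx' hA'.1 fun r c hr => ?_).mono le_rfl ?_
      · obtain ⟨r', rfl⟩ : ∃ r', r = base + r' := ⟨r - base, by omega⟩
        rw [hA'.2, if_neg]
        simp only [mem_box]
        omega
      · rintro s' rfl
        refine ⟨⟨fun _ _ => rfl, rfl⟩, fun A hA₁ => ?_, fun p' q' => ?_⟩
        · rw [valArr_setVal_of_ne _ _ _ hA₁, hA'.1 A hA₁]
        · rw [valArr_setVal, hA'.2]
          by_cases h : p' = p ∧ q' = q
          · rw [if_pos (by rw [h.1, h.2]), if_pos, h.1, h.2]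
            right
            omega
          · rw [if_neg fun h' => h ⟨by simpa using congrArg Prod.fst h', congrArg Prod.snd h'⟩]
            refine if_congr ?_ rfl rfl
            push_cast
            refine or_congr_right ?_
            omega
    · simp only [IntExpr.cost, Finset.sum_const, Nat.card_Ico, smul_eq_mul, Nat.sub_zero]
      rw [mul_comm N]
      have : B + (e'.cost + 8) = B + e'.cost + 8 := by omega
      rw [this]
      omega
    · rw [hs.2.2]
      refine if_congr ?_ rfl rfl
      simp only [mem_box]
      push_cast
      omega
  · simp only [IntExpr.cost, Finset.sum_const, Nat.card_Ico, smul_eq_mul, Nat.sub_zero]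
    rw [mul_comm M]
    have : (B + e'.cost + 8) * N + e'.cost + 6 + (e.cost + 8) =
      (B + e'.cost + 8) * N + e.cost + e'.cost + 14 := by omega
    rw [this]
    omega

theorem support_spread_subset {M N : ℤ} {v : ℤ × ℤ} (hv : 0 ≤ v.1) {G : ℤ × ℤ → V}
    (hG : G.support ⊆ box (M - v.1) (N - |v.2|)) : (spread v G).support ⊆ box M N := by
  intro x hx
  have : x - (v.1, max v.2 0) ∈ box (M - v.1) (N - |v.2|) ∨
      x - (0, max (-v.2) 0) ∈ box (M - v.1) (N - |v.2|) := by
    by_contra! h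
    apply hx
    rw [spread, Function.notMem_support.mp fun h' => h.1 (hG h'),
      Function.notMem_support.mp fun h' => h.2 (hG h'), sub_zero]
  simp only [mem_box, Prod.fst_sub, Prod.snd_sub] at this ⊢
  rcases abs_cases v.2 with h | h <;> omega

/-- `G` is a solution of the problem for the `i`-th remainder: it lives on the same box and has the
line sums of `F i` in all directions from `i` on. -/
structure Matches (m n d : ℕ) (dir : ℕ → ℤ × ℤ) (F : ℕ → ℤ × ℤ → V) (i : ℕ)
    (G : ℤ × ℤ → V) : Prop where
  support_subset : G.support ⊆ box (width m dir i) (height n dir i)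
  planeSum_eq : ∀ j, i ≤ j → j < d → ∀ c, planeSum (dir j) G c = planeSum (dir j) (F i) c

/-- A solution for one remainder gives a solution for the preceding one, since `spread` acts on line
sums and kills those in its own direction. -/
theorem Matches.step {m n d : ℕ} {dir : ℕ → ℤ × ℤ} {F : ℕ → ℤ × ℤ → V} {i : ℕ} {G : ℤ × ℤ → V}
    (h : Matches m n d dir F (i + 1) G) (hF : Decomposes m n d dir F) (hi : i < d)
    (hdir : IsDirection (dir i)) :
    Matches m n d dir F i fun x => seed (width m dir i) (height n dir i) (dir i)
      (planeSum (dir i) (F i)) x + spread (dir i) G x := by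
  have hs := support_seed_subset (width m dir i) (height n dir i) (dir i)
    (planeSum (dir i) (F i))
  have hG := h.support_subset
  rw [width_succ, height_succ] at hG
  have hGf := finite_support_of_subset_box hG
  have hFf := finite_support_of_subset_box (hF.support_subset (i + 1))
  refine ⟨(Function.support_add _ _).trans
    (Set.union_subset hs (support_spread_subset hdir.fst_nonneg hG)), fun j hij hj c => ?_⟩
  rw [planeSum_add (finite_support_of_subset_box hs) (finite_support_spread hGf _)]
  have h1 := hF.planeSum_spread_eq hi (dir j) c
  have h2 : planeSum (dir j) (spread (dir i) G) c =
      planeSum (dir j) (spread (dir i) (F (i + 1))) c := by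
    rcases hij.eq_or_lt with rfl | hij
    · rw [planeSum_spread_self hGf, planeSum_spread_self hFf]
    · rw [planeSum_spread hGf, planeSum_spread hFf, h.planeSum_eq j hij hj,
        h.planeSum_eq j hij hj]
  rw [h2, h1]
  abel

/-- `G` is stored as the `i`-th partial solution, and the memory of the earlier ones is still empty. -/
structure Stored (m i : ℕ) (W : ℕ → ℤ × ℤ → V) (G : ℤ × ℤ → V) : Prop where
  eq : ∀ p q : ℤ, -m < p → p < m → W 1 (2 * m * i + p, q) = G (p, q)
  zero : ∀ r q : ℤ, r ≤ 2 * m * i - m → W 1 (r, q) = 0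

/-- Store a solution for the last remainder: its values are its line sums in the direction `k`. If
all directions have been used, there are no line sums left to match. -/
def innermost : Program :=
  fill 6 (widthE (.reg 4)) (heightE (.reg 4)) (.setVal 1 (outRowE (.reg 4) (.reg 6)) (.reg 7)
    (.get 0 (rowE (.reg 4) (.reg 4)) (indexE (.reg 4) (.reg 6) (.reg 7))))

theorem runs_innermost {m n d k K : ℕ} {dir : ℕ → ℤ × ℤ} {s : State V}
    (h : Env m n d k K dir s) (hkd : k ≤ d) (hkK : k < d → k < K) (hm : 0 < m) (hn : 0 < n)
    (hdir : ∀ j < d, IsDirection (dir j)) (hM : 0 ≤ width m dir k) (hN : 0 ≤ height n dir k)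
    (hend : k < d → width m dir k ≤ (dir k).1 ∨ height n dir k ≤ |(dir k).2|)
    {F : ℕ → ℤ × ℤ → V} (hF : Decomposes m n d dir F)
    (hW : k < K → ∀ c, s.valArr 0 (k * d + k, c) = planeSum (dir k) (F k) c)
    (hW1 : s.valArr 1 = 0) :
    Runs innermost s (200 * (m * n)) fun s' => (Keeps 6 s s' ∧ s'.intArr = s.intArr) ∧
      s'.valArr 0 = s.valArr 0 ∧
      ∃ G, Matches m n d dir F k G ∧ Stored m k s'.valArr G := by
  obtain ⟨M, hM'⟩ : ∃ M : ℕ, width m dir k = M := ⟨_, (Int.toNat_of_nonneg hM).symm⟩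
  obtain ⟨N, hN'⟩ : ∃ N : ℕ, height n dir k = N := ⟨_, (Int.toNat_of_nonneg hN).symm⟩
  have hMm : M ≤ m := by
    have := width_le (m := m) hdir hkd
    omega
  have hNn : N ≤ n := by
    have := height_le n dir k
    omega
  let G : ℤ × ℤ → V := fun x =>
    if x ∈ box M N then s.valArr 0 (k * d + k, lineIndex (dir k) x) else 0
  refine (runs_fill (M := M) (N := N) (B := 40) (base := 2 * m * k) (G := G)
    (fun s' hk hI => ?_) (fun s' hk hI => ?_) fun p hp q hq s₁ hk hI h6 h7 hA _ => ?_).mono ?_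
    fun s' hs => ⟨hs.1, hs.2.1 0 (by omega), G, ⟨?_, fun j hkj hj c => ?_⟩,
      fun p q hp hp' => ?_, fun r q hr => ?_⟩
  · rw [(h.of_keeps hk le_rfl hI).eval_widthE (e := .reg 4) ((hk 4 (by omega)).trans h.reg4) hkd,
      hM']
  · rw [(h.of_keeps hk le_rfl hI).eval_heightE (e := .reg 4) ((hk 4 (by omega)).trans h.reg4) hkd,
      hN']
  · have h₁ := h.of_keeps hk le_rfl hI
    have e4 : (IntExpr.reg 4).eval s₁ = k := h₁.reg4
    have e6 : (IntExpr.reg 6).eval s₁ = p := h6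
    have e7 : (IntExpr.reg 7).eval s₁ = q := h7
    have hmem : ((p : ℤ), (q : ℤ)) ∈ box M N := by simp [mem_box, hp, hq]
    refine (Runs.setVal ?_).mono (by decide) fun s' hs => hs
    rw [ValExpr.eval, h₁.eval_outRowE e4 e6, h₁.eval_rowE e4 e4, h₁.eval_indexE e4 e6 e7,
      hA 0 (by omega)]
    simp only [G, if_pos hmem, e7]
  · simp only [IntExpr.cost, widthE, heightE]
    have h1 : M * N ≤ m * n := Nat.mul_le_mul hMm hNn
    have h2 : m ≤ m * n := Nat.le_mul_of_pos_right m hn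
    nlinarith
  · rw [hM', hN']
    intro x hx
    by_contra h'
    exact hx (if_neg h')
  · have hkd' : k < d := by omega
    have hbox := hF.support_subset k
    have : G = F k := by
      funext x
      by_cases hx : x ∈ box M N
      · simp only [G, if_pos hx]
        rw [← hM', ← hN'] at hx
        rw [hW (hkK hkd'), planeSum_eq_apply (hdir k hkd') hbox (hend hkd') hx]
      · simp only [G, if_neg hx]
        rw [← hM', ← hN'] at hx
        exact (Function.notMem_support.mp fun h' => hx (hbox h')).symm
    rw [this]
  · rw [hs.2.2, hW1]
    simp only [G, Pi.zero_apply]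
    split_ifs <;> rfl
  · obtain ⟨p, rfl⟩ : ∃ p, r = 2 * m * k + p := ⟨r - 2 * m * k, by omega⟩
    rw [hs.2.2, hW1, if_neg]
    · rfl
    · simp only [mem_box]
      omega

/-- Add the seed to the spread of the solution with the next number. -/
def backwardBody : Program :=
  fill 8 (widthE (.reg 7)) (heightE (.reg 7)) (.ite (interiorC (.reg 7) (.reg 8) (.reg 9))
    (.setVal 1 (outRowE (.reg 7) (.reg 8)) (.reg 9)
      (.sub (.get 1 (outRowE (.add (.reg 7) (.const 1)) (.sub (.reg 8) (fstE (.reg 7))))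
          (.sub (.reg 9) (posE (.reg 7))))
        (.get 1 (outRowE (.add (.reg 7) (.const 1)) (.reg 8)) (.sub (.reg 9) (negE (.reg 7))))))
    (.setVal 1 (outRowE (.reg 7) (.reg 8)) (.reg 9)
      (.add (.get 0 (rowE (.reg 7) (.reg 7)) (indexE (.reg 7) (.reg 8) (.reg 9)))
        (.sub (.get 1 (outRowE (.add (.reg 7) (.const 1)) (.sub (.reg 8) (fstE (.reg 7))))
            (.sub (.reg 9) (posE (.reg 7))))
          (.get 1 (outRowE (.add (.reg 7) (.const 1)) (.reg 8))
            (.sub (.reg 9) (negE (.reg 7))))))))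

theorem runs_backwardBody {m n d k K : ℕ} {dir : ℕ → ℤ × ℤ} {s : State V}
    (h : Env m n d k K dir s) {i : ℕ} (hi : s.reg 7 = i) (hid : i < d) (hm : 0 < m) (hn : 0 < n)
    (hdir : ∀ j < d, IsDirection (dir j)) (hM : 0 < width m dir (i + 1))
    (hN : 0 < height n dir (i + 1)) {F : ℕ → ℤ × ℤ → V} (hF : Decomposes m n d dir F)
    (hW : ∀ c, s.valArr 0 (i * d + i, c) = planeSum (dir i) (F i) c) {G : ℤ × ℤ → V}
    (hG : Matches m n d dir F (i + 1) G) (hst : Stored m (i + 1) s.valArr G) :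
    Runs backwardBody s (300 * (m * n)) fun s' => (Keeps 8 s s' ∧ s'.intArr = s.intArr) ∧
      s'.valArr 0 = s.valArr 0 ∧
      ∃ G', Matches m n d dir F i G' ∧ Stored m i s'.valArr G' := by
  have hdi := hdir i hid
  rw [width_succ] at hM
  rw [height_succ] at hN
  have ha := hdi.fst_nonneg
  have hb := abs_nonneg (dir i).2
  obtain ⟨M, hM'⟩ : ∃ M : ℕ, width m dir i = M := ⟨_, (Int.toNat_of_nonneg (by omega)).symm⟩
  obtain ⟨N, hN'⟩ : ∃ N : ℕ, height n dir i = N := ⟨_, (Int.toNat_of_nonneg (by omega)).symm⟩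
  have hMm : M ≤ m := by
    have := width_le (m := m) hdir hid.le
    omega
  have hNn : N ≤ n := by
    have := height_le n dir i
    omega
  have hstep := hG.step hF hid hdi
  set G' : ℤ × ℤ → V := fun x => seed (width m dir i) (height n dir i) (dir i)
      (planeSum (dir i) (F i)) x + spread (dir i) G x with hG'
  refine (runs_fill (M := M) (N := N) (B := 120) (base := 2 * m * i) (G := G')
    (fun s' hk hI => ?_) (fun s' hk hI => ?_) fun p hp q hq s₁ hk hI h8 h9 hA hA1 => ?_).mono ?_
    fun s' hs => ⟨hs.1, hs.2.1 0 (by omega), G', hstep, fun p q hp hp' => ?_, fun r q hr => ?_⟩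
  · rw [(h.of_keeps hk (by omega) hI).eval_widthE (e := .reg 7) ((hk 7 (by omega)).trans hi)
      hid.le, hM']
  · rw [(h.of_keeps hk (by omega) hI).eval_heightE (e := .reg 7) ((hk 7 (by omega)).trans hi)
      hid.le, hN']
  · have h₁ := h.of_keeps hk (by omega) hI
    have e7 : (IntExpr.reg 7).eval s₁ = i := (hk 7 (by omega)).trans hi
    have e8 : (IntExpr.reg 8).eval s₁ = p := h8
    have e9 : (IntExpr.reg 9).eval s₁ = q := h9
    have e7' : (IntExpr.add (.reg 7) (.const 1)).eval s₁ = (i : ℤ) + 1 := by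
      rw [IntExpr.eval, e7, IntExpr.eval]
    have e8' : (IntExpr.sub (.reg 8) (fstE (.reg 7))).eval s₁ = p - (dir i).1 := by
      rw [IntExpr.eval, e8, h₁.eval_fstE e7]
    have e9' : (IntExpr.sub (.reg 9) (posE (.reg 7))).eval s₁ = q - max (dir i).2 0 := by
      rw [IntExpr.eval, e9, h₁.eval_posE e7 hid]
    have e9'' : (IntExpr.sub (.reg 9) (negE (.reg 7))).eval s₁ = q - max (-(dir i).2) 0 := by
      rw [IntExpr.eval, e9, h₁.eval_negE e7 hid]
    have hmem : ((p : ℤ), (q : ℤ)) ∈ box M N := by simp [mem_box, hp, hq]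
    have hint := h₁.holds_interiorC e7 e8 e9 hid hN' ha hp hq
    have hread : ∀ p' q' : ℤ, -m < p' → p' < m →
        s₁.valArr 1 (2 * m * (i + 1) + p', q') = G (p', q') := by
      intro p' q' h1 h2
      rw [hA1 _ _ (by linarith)]
      have := hst.eq p' q' h1 h2
      push_cast at this
      exact this
    have hspread : s₁.valArr 1 (2 * m * (i + 1) + (p - (dir i).1), q - max (dir i).2 0) -
        s₁.valArr 1 (2 * m * (i + 1) + p, q - max (-(dir i).2) 0) =
        spread (dir i) G (p, q) := by
      rw [hread _ _ (by omega) (by omega), hread _ _ (by omega) (by omega), spread]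
      simp
    refine (Runs.ite (B := 80) (fun hc => ?_) fun hc => ?_).mono (by decide) fun s' hs => hs
    · rw [hint] at hc
      refine (Runs.setVal ?_).mono (by decide) fun s' hs => hs
      have : G' ((p : ℤ), (q : ℤ)) = spread (dir i) G (p, q) := by
        rw [hG', hM', hN']
        simp [seed, hc]
      rw [ValExpr.eval, ValExpr.eval, ValExpr.eval, h₁.eval_outRowE e7 e8, e9,
        h₁.eval_outRowE e7' e8', h₁.eval_outRowE e7' e8, e9', e9'', hspread, this]
    · rw [hint] at hc
      refine (Runs.setVal ?_).mono (by decide) fun s' hs => hs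
      have : G' ((p : ℤ), (q : ℤ)) = planeSum (dir i) (F i) (lineIndex (dir i) (p, q)) +
          spread (dir i) G (p, q) := by
        rw [hG', hM', hN']
        simp [seed, hc, hmem]
      rw [ValExpr.eval, ValExpr.eval, ValExpr.eval, ValExpr.eval, ValExpr.eval,
        h₁.eval_outRowE e7 e8, e9, h₁.eval_outRowE e7' e8', h₁.eval_outRowE e7' e8, e9', e9'',
        hspread, this, h₁.eval_rowE e7 e7, h₁.eval_indexE e7 e8 e9, hA 0 (by omega), hW]
  · simp only [IntExpr.cost, widthE, heightE]
    have h1 : M * N ≤ m * n := Nat.mul_le_mul hMm hNn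
    have h2 : m ≤ m * n := Nat.le_mul_of_pos_right m hn
    nlinarith
  · have hz := hst.zero (2 * m * i + p) q (by push_cast; linarith)
    rw [hs.2.2, hz]
    split_ifs with hc
    · rfl
    · rw [← hM', ← hN'] at hc
      exact (Function.notMem_support.mp fun h' => hc (hstep.support_subset h')).symm
  · obtain ⟨p, rfl⟩ : ∃ p, r = 2 * m * i + p := ⟨r - 2 * m * i, by omega⟩
    rw [hs.2.2, if_neg]
    · exact hst.zero _ _ (by push_cast; linarith)
    · simp only [mem_box]
      omega

/-- Assemble the solution, from the last remainder back to the given function. -/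
def backward : Program :=
  forLoop 6 (.const 0) (.reg 4)
    (.seq (.setReg 7 (.sub (.sub (.reg 4) (.const 1)) (.reg 6))) backwardBody)

theorem runs_backward {m n d k K : ℕ} {dir : ℕ → ℤ × ℤ} {s : State V}
    (h : Env m n d k K dir s) (hkd : k ≤ d) (hm : 0 < m) (hn : 0 < n)
    (hdir : ∀ j < d, IsDirection (dir j)) (hM : ∀ i ≤ k, 0 < width m dir i)
    (hN : ∀ i ≤ k, 0 < height n dir i) {F : ℕ → ℤ × ℤ → V} (hF : Decomposes m n d dir F)
    (hW : ∀ i < k, ∀ c, s.valArr 0 (i * d + i, c) = planeSum (dir i) (F i) c)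
    {G : ℤ × ℤ → V} (hG : Matches m n d dir F k G) (hst : Stored m k s.valArr G) :
    Runs backward s (320 * (m * n) * k + 10) fun s' =>
      ∃ G', Matches m n d dir F 0 G' ∧ Stored m 0 s'.valArr G' := by
  refine (runs_forLoop (lo := 0) (hi := k) (B := fun _ => 300 * (m * n) + 8) (fun t W =>
      W 0 = s.valArr 0 ∧ ∃ G', Matches m n d dir F (k - t) G' ∧ Stored m (k - t) W G')
    (Nat.zero_le _) (by simp [IntExpr.eval])
    (fun s' hk _ => by simp [IntExpr.eval, hk 4 (by omega), h.reg4]) ⟨rfl, G, hG, hst⟩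
    fun t s₁ _ htk hk hI hx hA => ?_).mono ?_ fun s' hs => by simpa using hs.2.2
  · have h₁ := h.of_keeps hk (by omega) hI
    obtain ⟨hA0, G₁, hG₁, hst₁⟩ := hA
    obtain ⟨i, hi⟩ : ∃ i, k - t = i + 1 := ⟨k - t - 1, by omega⟩
    rw [hi] at hG₁ hst₁
    refine (Runs.seq (R := fun s' => s' = s₁.setReg 7 i) (B' := 300 * (m * n))
      (Runs.setReg ?_) fun s₂ hs₂ => ?_).mono ?_ fun s' hs => hs
    · simp only [IntExpr.eval, h₁.reg4, hx]
      congr 1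
      omega
    · have hk₂ : Keeps 7 s₁ s₂ := hs₂ ▸ Keeps.setReg _ _ le_rfl
      subst hs₂
      refine (runs_backwardBody (h₁.of_keeps hk₂ (by omega) rfl) (i := i)
        (by simp [State.setReg]) (by omega) hm hn hdir (hM _ (by omega)) (hN _ (by omega)) hF
        (fun c => ?_) hG₁ hst₁).mono le_rfl fun s' hs =>
          ⟨⟨hk₂.trans (hs.1.1.mono (by omega)), hs.1.2⟩, hs.2.1.trans hA0, ?_⟩
      · rw [← hW i (by omega) c, ← hA0]
        rfl
      · rw [show k - (t + 1) = i by omega]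
        exact hs.2.2
    · simp only [IntExpr.cost]
      omega
  · simp only [IntExpr.cost, Finset.sum_const, Nat.card_Ico, smul_eq_mul, Nat.sub_zero]
    have h5 : 0 < m * n := Nat.mul_pos hm hn
    nlinarith

end

/-! ### Tabulating the directions -/

section

variable {V : Type*}

theorem intArr_setInt (s : State V) (A : ℕ) (c c' : ℤ × ℤ) (z : ℤ) :
    (s.setInt A c z).intArr A c' = if c' = c then z else s.intArr A c' := by
  simp [State.setInt, Function.update_apply]

theorem intArr_setInt_of_ne (s : State V) {A A' : ℕ} (c : ℤ × ℤ) (z : ℤ) (h : A' ≠ A) :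
    (s.setInt A c z).intArr A' = s.intArr A' := by
  simp [State.setInt, h]

variable [AddCommGroup V]

/-- Tabulate the positive and negative part of the second coordinate of a direction. -/
def splitSnd : Program :=
  .ite (.le (.const 0) (sndE (.reg 3)))
    (.seq (.setInt 1 (.reg 3) (.const 2) (sndE (.reg 3)))
      (.setInt 1 (.reg 3) (.const 3) (.const 0)))
    (.seq (.setInt 1 (.reg 3) (.const 2) (.const 0))
      (.setInt 1 (.reg 3) (.const 3) (.sub (.const 0) (sndE (.reg 3)))))

/-- Tabulate the data of one direction and the box that it leaves. -/
def tabulateBody : Program :=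
  .seq splitSnd (.seq
    (.setInt 1 (.add (.reg 3) (.const 1)) (.const 0) (.sub (widthE (.reg 3)) (fstE (.reg 3))))
    (.setInt 1 (.add (.reg 3) (.const 1)) (.const 1)
      (.sub (heightE (.reg 3)) (.add (posE (.reg 3)) (negE (.reg 3))))))

/-- Set up the integer array `1` as described by `Tables`. -/
def tabulate : Program :=
  .seq (.setInt 1 (.const 0) (.const 0) (.reg 0)) (.seq
    (.setInt 1 (.const 0) (.const 1) (.reg 1)) (forLoop 3 (.const 0) (.reg 2) tabulateBody))

theorem runs_splitSnd {s : State V} {h : ℕ} {b : ℤ} (hh : s.reg 3 = h)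
    (hb : s.intArr 0 (h, 1) = b) :
    Runs splitSnd s 40 fun s' => s' = (s.setInt 1 (h, 2) (max b 0)).setInt 1 (h, 3) (max (-b) 0) := by
  have hcond : (Cond.le (.const 0) (sndE (.reg 3))).Holds s ↔ 0 ≤ b := by
    simp [Cond.Holds, IntExpr.eval, sndE, hh, hb]
  have hb' : ∀ z, (s.setInt 1 (h, 2) z).intArr 0 (h, 1) = b := fun z => by
    rw [intArr_setInt_of_ne _ _ _ (by omega), hb]
  have hh' : ∀ z, (s.setInt 1 (h, 2) z).reg 3 = h := fun z => hh
  refine (Runs.ite (B := 30) (fun hc => ?_) fun hc => ?_).mono (by decide) fun s' hs => hs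
  · rw [hcond] at hc
    refine (Runs.seq (R := fun s' => s' = s.setInt 1 (h, 2) (max b 0)) (Runs.setInt ?_)
      fun s₁ hs₁ => Runs.setInt ?_).mono (by decide) fun s' hs => hs
    · simp [IntExpr.eval, sndE, hh, hb, hc]
    · subst hs₁
      simp [IntExpr.eval, hh', hc]
  · rw [hcond] at hc
    refine (Runs.seq (R := fun s' => s' = s.setInt 1 (h, 2) (max b 0)) (Runs.setInt ?_)
      fun s₁ hs₁ => Runs.setInt ?_).mono (by decide) fun s' hs => hs
    · simp [IntExpr.eval, hh, max_eq_right (not_le.mp hc).le]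
    · subst hs₁
      have : max (-b) 0 = -b := max_eq_left (by omega)
      simp [IntExpr.eval, sndE, hh', hb', this]

theorem runs_tabulate {m n d : ℕ} {dir : ℕ → ℤ × ℤ} {s : State V} (hm : s.reg 0 = m)
    (hn : s.reg 1 = n) (hd : s.reg 2 = d) (h0 : ∀ h : ℕ, s.intArr 0 (h, 0) = (dir h).1)
    (h1 : ∀ h : ℕ, s.intArr 0 (h, 1) = (dir h).2) :
    Runs tabulate s (110 * d + 30) fun s' =>
      Keeps 3 s s' ∧ Tables m n d dir s'.intArr ∧ s'.valArr = s.valArr := by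
  refine (Runs.seq (R := fun s' => s' = s.setInt 1 (0, 0) m) (Runs.setInt (by
      simp [IntExpr.eval, hm])) fun s₁ hs₁ => (Runs.seq (B' := 110 * d + 10)
    (R := fun s' => s' = (s.setInt 1 (0, 0) m).setInt 1 (0, 1) n)
    (Runs.setInt (by subst hs₁; simp [IntExpr.eval, State.setInt, hn])) fun s₂ hs₂ => ?_)).mono
      (B' := 110 * d + 30) (by simp only [IntExpr.cost]; omega) fun s' hs => hs
  have hk₂ : Keeps 3 s s₂ := by
    subst hs₂
    exact fun _ _ => rfl
  refine (runs_forLoop' (lo := 0) (hi := d) (B := fun _ => 100) (fun t I W =>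
    I 0 = s.intArr 0 ∧ W = s.valArr ∧ (∀ h ≤ t, I 1 (h, 0) = width m dir h) ∧
    (∀ h ≤ t, I 1 (h, 1) = height n dir h) ∧ (∀ h < t, I 1 (h, 2) = max (dir h).2 0) ∧
    ∀ h < t, I 1 (h, 3) = max (-(dir h).2) 0) (Nat.zero_le _) (by simp [IntExpr.eval])
    (fun t s' _ _ hk _ => by simp [IntExpr.eval, hk 2 (by omega), hk₂ 2 (by omega), hd]) ?_
    fun t s' _ htd hk hx hA => ?_).mono ?_ fun s' hs => ⟨hk₂.trans hs.1, ?_, hs.2.2.1⟩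
  · subst hs₂
    refine ⟨?_, rfl, fun h hh => ?_, fun h hh => ?_, fun h hh => by omega, fun h hh => by omega⟩
    · rw [intArr_setInt_of_ne _ _ _ (by omega), intArr_setInt_of_ne _ _ _ (by omega)]
    all_goals
      obtain rfl : h = 0 := by omega
      simp [intArr_setInt, width, height]
  · obtain ⟨hA0, hAW, hAw, hAh, hAp, hAn⟩ := hA
    refine (Runs.seq (runs_splitSnd hx (b := (dir t).2) (by rw [hA0, h1]))
      fun s₃ hs₃ => Runs.seq (R := fun s₄ => s₄ = s₃.setInt 1 (t + 1, 0)
        (width m dir (t + 1))) (Runs.setInt ?_) fun s₄ hs₄ => Runs.setInt ?_).mono (by decide)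
        fun s' hs => hs
    · subst hs₃
      rw [width_succ, ← hAw t le_rfl, ← h0, ← hA0]
      simp [IntExpr.eval, widthE, fstE, State.setInt, hx]
    · subst hs₃ hs₄
      have e3 : IntExpr.eval (((s'.setInt 1 (↑t, 2) (max (dir t).2 0)).setInt 1 (↑t, 3)
          (max (-(dir t).2) 0)).setInt 1 (↑t + 1, 0) (width m dir (t + 1)))
          (.sub (heightE (.reg 3)) (.add (posE (.reg 3)) (negE (.reg 3)))) =
          height n dir (t + 1) := by
        rw [height_succ, ← hAh t le_rfl]
        simp [IntExpr.eval, heightE, posE, negE, State.setInt, hx]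
      rw [e3]
      have e4 : IntExpr.eval (((s'.setInt 1 (↑t, 2) (max (dir t).2 0)).setInt 1 (↑t, 3)
          (max (-(dir t).2) 0)).setInt 1 (↑t + 1, 0) (width m dir (t + 1)))
          (.add (.reg 3) (.const 1)) = t + 1 := by
        simp [IntExpr.eval, State.setInt, hx]
      rw [e4]
      refine ⟨fun _ _ => rfl, ?_, hAW, fun h hh => ?_, fun h hh => ?_, fun h hh => ?_,
        fun h hh => ?_⟩
      · simp [State.setInt, hA0]
      all_goals simp only [intArr_setInt, IntExpr.eval, Prod.mk.injEq]
      · by_cases hht : h = t + 1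
        · subst hht; simp
        · have : (h : ℤ) ≠ t + 1 := by omega
          simp [this, hAw h (by omega)]
      · by_cases hht : h = t + 1
        · subst hht; simp
        · have : (h : ℤ) ≠ t + 1 := by omega
          simp [this, hAh h (by omega)]
      · by_cases hht : h = t
        · subst hht; simp
        · simp [hht, hAp h (by omega)]
      · by_cases hht : h = t
        · subst hht; simp
        · simp [hht, hAn h (by omega)]
  · simp only [IntExpr.cost, Finset.sum_const, Nat.card_Ico, smul_eq_mul]
    omega
  · obtain ⟨hA0, hAW, hAw, hAh, hAp, hAn⟩ := hs.2
    exact ⟨fun h => by rw [hA0, h0], fun h => by rw [hA0, h1], hAw, hAh, hAp, hAn⟩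

end

/-! ### The program and its cost -/

section

variable {V : Type*}

/-- There is a direction with the number in register `x`, and it fits into the `e × e'` box. -/
def fitsC (x : ℕ) (e e' : IntExpr) : Cond :=
  .and (.lt (.reg x) (.reg 2)) (.and (.lt (fstE (.reg x)) e) (.and (.lt (sndE (.reg x)) e')
    (.lt (.sub (.const 0) (sndE (.reg x))) e')))

theorem holds_fitsC {x : ℕ} {e e' : IntExpr} {s : State V} {d i : ℕ} {v : ℤ × ℤ} {M N : ℤ}
    (hd : s.reg 2 = d) (hx : s.reg x = i) (h0 : s.intArr 0 (i, 0) = v.1)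
    (h1 : s.intArr 0 (i, 1) = v.2) (he : i < d → e.eval s = M) (he' : i < d → e'.eval s = N) :
    (fitsC x e e').Holds s ↔ i < d ∧ v.1 < M ∧ |v.2| < N := by
  simp only [fitsC, Cond.Holds, Cond.holds_lt, IntExpr.eval, fstE, sndE, hd, hx, h0, h1,
    Nat.cast_lt, zero_sub, abs_lt]
  by_cases hi : i < d
  · rw [he hi, he' hi]
    omega
  · simp [hi]

variable [AddCommGroup V]

/-- Use a direction in which every line meets the grid in at most one point. -/
def readOff : Program :=
  fill 4 (.reg 0) (.reg 1) (.setVal 1 (.reg 4) (.reg 5)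
    (.get 0 (.reg 3) (indexE (.reg 3) (.reg 4) (.reg 5))))

/-- The algorithm for the case that every direction fits into the grid. -/
def interpolate : Program :=
  .seq (search 4 (fitsC 4 (widthE (.reg 4)) (heightE (.reg 4)))) (.seq
    (.ite (.lt (.reg 4) (.reg 2)) (.setReg 5 (.add (.reg 4) (.const 1))) (.setReg 5 (.reg 2)))
    (.seq forward (.seq innermost backward)))

/-- The whole program. Register `3` receives the number of the first direction not fitting into the
grid, or `d` if there is none. -/
def reconstruct : Program :=
  .seq tabulate (.seq (search 3 (fitsC 3 (.reg 0) (.reg 1)))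
    (.ite (.lt (.reg 3) (.reg 2)) readOff interpolate))

theorem runs_readOff {m n h : ℕ} {v : ℤ × ℤ} {s : State V} (hm : s.reg 0 = m) (hn : s.reg 1 = n)
    (hm0 : 0 < m) (hn0 : 0 < n) (hh : s.reg 3 = h) (h0 : s.intArr 0 (h, 0) = v.1)
    (h1 : s.intArr 0 (h, 1) = v.2) (hv : IsDirection v) (hbad : m ≤ v.1 ∨ n ≤ |v.2|)
    {f : ℤ × ℤ → V} (hf : f.support ⊆ box m n) (hL : ∀ c, s.valArr 0 (h, c) = planeSum v f c) :
    Runs readOff s (200 * (m * n)) fun s' => ∀ x ∈ box m n, s'.valArr 1 x = f x := by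
  refine (runs_fill (M := m) (N := n) (B := 30) (base := 0) (G := f)
    (fun s' hk _ => by rw [IntExpr.eval, hk 0 (by omega), hm])
    (fun s' hk _ => by rw [IntExpr.eval, hk 1 (by omega), hn])
    fun p hp q hq s₁ hk hI h4 h5 hA _ => ?_).mono ?_ fun s' hs x hx => ?_
  · have e3 : (IntExpr.reg 3).eval s₁ = h := (hk 3 (by omega)).trans hh
    have e4 : (IntExpr.reg 4).eval s₁ = p := h4
    have e5 : (IntExpr.reg 5).eval s₁ = q := h5
    have hidx : (indexE (.reg 3) (.reg 4) (.reg 5)).eval s₁ = lineIndex v (p, q) := by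
      simp only [indexE, fstE, sndE, IntExpr.eval] at e3 e4 e5 ⊢
      rw [e3, e4, e5, hI, h0, h1, lineIndex]
    refine (Runs.setVal ?_).mono (by decide) fun s' hs => hs
    rw [ValExpr.eval, hidx, e3, e4, e5, hA 0 (by omega), hL,
      planeSum_eq_apply hv hf hbad (by simp [mem_box, hp, hq]), zero_add]
  · simp only [IntExpr.cost]
    have h2 : m ≤ m * n := Nat.le_mul_of_pos_right m hn0
    have h5 : 0 < m * n := Nat.mul_pos hm0 hn0
    nlinarith
  · have := hs.2.2 x.1 x.2
    rwa [zero_add, if_pos hx] at this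

theorem one_le_weight {m n : ℕ} (hm : 0 < m) (hn : 0 < n) {v : ℤ × ℤ} (hv : IsDirection v) :
    1 ≤ weight m n v := by
  rcases hv.2 with h | h
  · have : 0 < v.1.natAbs * n := Nat.mul_pos (by omega) hn
    rw [weight]
    omega
  · simp [weight, h]
    omega

/-- As the boxes left by the first `k` directions are not empty, these directions have a small total
weight. -/
theorem sum_weight_le {m n d k : ℕ} {dir : ℕ → ℤ × ℤ} (hdir : ∀ j < d, IsDirection (dir j))
    (hkd : k ≤ d) (hM : 0 < width m dir k) (hN : 0 < height n dir k) :
    ∑ i ∈ Finset.range k, weight m n (dir i) ≤ 2 * (m * n) := by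
  have h1 : ∑ i ∈ Finset.range k, (dir i).1.natAbs ≤ m := by
    zify
    rw [width] at hM
    rw [Finset.sum_congr rfl fun i hi => abs_of_nonneg
      (hdir i ((Finset.mem_range.mp hi).trans_le hkd)).fst_nonneg]
    omega
  have h2 : ∑ i ∈ Finset.range k, (dir i).2.natAbs ≤ n := by
    zify
    rw [height] at hN
    omega
  simp only [weight, Finset.sum_add_distrib, ← Finset.sum_mul]
  have h3 := Nat.mul_le_mul_right n h1
  have h4 := Nat.mul_le_mul_right m h2
  nlinarith

/-- The direction in which the last remainder is read off may not fit into its box, but it fits into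
the grid, so it has weight at most `2 m n` as well. -/
theorem forward_cost_le {m n d k K : ℕ} {dir : ℕ → ℤ × ℤ} (hm : 0 < m) (hn : 0 < n)
    (hdir : ∀ j < d, IsDirection (dir j)) (hkd : k ≤ d) (hKd : K ≤ d) (hKk : K ≤ k + 1)
    (hfit : ∀ j < d, (dir j).1 < m ∧ |(dir j).2| < n) (hM : 0 < width m dir k)
    (hN : 0 < height n dir k) :
    ∑ i ∈ Finset.range k, (100 * K * weight m n (dir i) + 120 * (m * n) +
      ∑ j ∈ Finset.range K, 210 * (weight m n (dir j) + 1) + 30) + 10 ≤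
      2100 * (d * m * n) + 10 := by
  have h1 := sum_weight_le hdir hkd hM hN
  have h2 : ∑ j ∈ Finset.range K, weight m n (dir j) ≤ 4 * (m * n) := by
    rcases hKk.lt_or_eq with h | rfl
    · refine (Finset.sum_le_sum_of_subset (t := Finset.range k) ?_).trans (by omega)
      exact Finset.range_subset_range.mpr (by omega)
    · rw [Finset.sum_range_succ]
      obtain ⟨h3, h4⟩ := hfit k (by omega)
      have h5 := (hdir k (by omega)).fst_nonneg
      have h6 : (dir k).1.natAbs ≤ m := by omega
      have h7 : (dir k).2.natAbs ≤ n := by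
        zify
        omega
      have h8 := Nat.mul_le_mul_right n h6
      have h9 := Nat.mul_le_mul_right m h7
      have : weight m n (dir k) ≤ 2 * (m * n) := by
        rw [weight]
        nlinarith
      omega
  have h3 : ∑ j ∈ Finset.range K, 210 * (weight m n (dir j) + 1) ≤ 1680 * (m * n) := by
    have : ∑ j ∈ Finset.range K, 210 * (weight m n (dir j) + 1) ≤
        ∑ j ∈ Finset.range K, 420 * weight m n (dir j) :=
      Finset.sum_le_sum fun j hj => by
        have := one_le_weight hm hn (hdir j ((Finset.mem_range.mp hj).trans_le hKd))
        omega
    have e : ∑ j ∈ Finset.range K, 420 * weight m n (dir j) =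
        420 * ∑ j ∈ Finset.range K, weight m n (dir j) := (Finset.mul_sum _ _ _).symm
    omega
  have h4 : 0 < m * n := Nat.mul_pos hm hn
  have h5 : ∑ i ∈ Finset.range k, (100 * K * weight m n (dir i) + 120 * (m * n) +
      ∑ j ∈ Finset.range K, 210 * (weight m n (dir j) + 1) + 30) ≤
      100 * K * ∑ i ∈ Finset.range k, weight m n (dir i) + k * (1830 * (m * n)) := by
    rw [Finset.mul_sum]
    have : k * (1830 * (m * n)) = ∑ i ∈ Finset.range k, 1830 * (m * n) := by simp
    rw [this, ← Finset.sum_add_distrib]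
    exact Finset.sum_le_sum fun i _ => by omega
  have h6 : 100 * K * ∑ i ∈ Finset.range k, weight m n (dir i) ≤ 100 * d * (2 * (m * n)) :=
    Nat.mul_le_mul (Nat.mul_le_mul_left _ hKd) h1
  have h7 : k * (1830 * (m * n)) ≤ d * (1830 * (m * n)) := Nat.mul_le_mul_right _ hkd
  have h8 : 100 * d * (2 * (m * n)) + d * (1830 * (m * n)) ≤ 2100 * (d * m * n) := by
    have : 100 * d * (2 * (m * n)) + d * (1830 * (m * n)) = 2030 * (d * m * n) := by ring
    omega
  omega

theorem runs_interpolate {m n d : ℕ} {dir : ℕ → ℤ × ℤ} {s : State V} (hr0 : s.reg 0 = m)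
    (hr1 : s.reg 1 = n) (hr2 : s.reg 2 = d) (hT : Tables m n d dir s.intArr) (hm : 0 < m)
    (hn : 0 < n) (hd : 0 < d) (hdir : ∀ j < d, IsDirection (dir j))
    (hinj : ∀ i < d, ∀ j < d, i ≠ j → dir i ≠ dir j)
    (hfit : ∀ j < d, (dir j).1 < m ∧ |(dir j).2| < n) {f : ℤ × ℤ → V} (hf : f.support ⊆ box m n)
    (hL : ∀ j < d, ∀ c : ℤ, s.valArr 0 (j, c) = planeSum (dir j) f c)
    (h0 : ∀ r c : ℤ, d ≤ r → s.valArr 0 (r, c) = 0) (h1 : s.valArr 1 = 0) :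
    Runs interpolate s (4000 * (d * m * n)) fun s' => ∃ G : ℤ × ℤ → V, G.support ⊆ box m n ∧
      (∀ j < d, ∀ c, planeSum (dir j) G c = planeSum (dir j) f c) ∧
      ∀ x ∈ box m n, s'.valArr 1 x = G x := by
  -- Register `4` receives the first `k` for which direction `k` does not fit into the remaining box.
  obtain ⟨F, rfl, hF⟩ := exists_decomposes hdir hf
  let p : ℕ → Prop := fun i => i < d ∧ (dir i).1 < width m dir i ∧ |(dir i).2| < height n dir i
  have hex : ∃ k, ¬ p k := ⟨d, fun h => lt_irrefl _ h.1⟩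
  obtain ⟨k, hpk, hk⟩ : ∃ k, ¬ p k ∧ ∀ i < k, p i := by
    classical
    exact ⟨Nat.find hex, Nat.find_spec hex, fun i hi => not_not.mp (Nat.find_min hex hi)⟩
  have hkd : k ≤ d := by
    by_contra h
    exact lt_irrefl _ (hk d (by omega)).1
  have hpos : ∀ i ≤ k, 0 < width m dir i ∧ 0 < height n dir i := by
    rintro (_ | i) hi
    · simp [width, height, hm, hn]
    · obtain ⟨-, h2, h3⟩ := hk i (by omega)
      rw [width_succ, height_succ]
      omega
  obtain ⟨K, hK⟩ : ∃ K, K = if k < d then k + 1 else d := ⟨_, rfl⟩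
  have hKd : K ≤ d := by split_ifs at hK <;> omega
  have hkK : k ≤ K := by split_ifs at hK <;> omega
  have hKk : K ≤ k + 1 := by split_ifs at hK <;> omega
  have hkK' : k < d → k < K := fun h => by rw [hK, if_pos h]; omega
  have hmn : 0 < d * m * n := Nat.mul_pos (Nat.mul_pos hd hm) hn
  have hmn' : m * n ≤ d * m * n := by
    rw [mul_assoc]
    exact Nat.le_mul_of_pos_left _ hd
  have hdm : d ≤ d * m * n := by
    rw [mul_assoc]
    exact Nat.le_mul_of_pos_right _ (Nat.mul_pos hm hn)
  have hcost : (fitsC 4 (widthE (.reg 4)) (heightE (.reg 4))).cost = 33 := rfl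
  refine (Runs.seq (runs_search (k := k) (p := p) (fun j => ?_) hk hpk)
    (B' := 20 + 3000 * (d * m * n)) fun s₁ hs₁ =>
    Runs.seq (R := fun s₂ => s₂ = s₁.setReg 5 K) (B := 20) ?_ fun s₂ hs₂ => ?_).mono ?_
      fun s' hs => hs
  · have hx : ∀ j : ℕ, (s.setReg 4 j).reg 4 = j := fun j => by simp [State.setReg]
    refine holds_fitsC hr2 (hx j) (hT.fst j) (hT.snd j) (fun hj => ?_) fun hj => ?_
    · rw [widthE, IntExpr.eval, IntExpr.eval, IntExpr.eval, hx]
      exact hT.width j hj.le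
    · rw [heightE, IntExpr.eval, IntExpr.eval, IntExpr.eval, hx]
      exact hT.height j hj.le
  · have h2 : s₁.reg 2 = d := by rw [hs₁]; exact hr2
    have h4 : s₁.reg 4 = k := by rw [hs₁]; simp [State.setReg]
    have hc : (Cond.lt (.reg 4) (.reg 2)).Holds s₁ ↔ k < d := by
      rw [Cond.holds_lt, IntExpr.eval, IntExpr.eval, h2, h4, Nat.cast_lt]
    refine (Runs.ite (B := 5) (fun h => (Runs.setReg ?_).mono (by decide) fun s' hs => hs)
      fun h => (Runs.setReg ?_).mono (by decide) fun s' hs => hs).mono (by decide) fun s' hs => hs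
    · rw [hc] at h
      rw [hK, if_pos h]
      simp [IntExpr.eval, h4]
    · rw [hc] at h
      rw [hK, if_neg h]
      simp [IntExpr.eval, h2]
  · have henv : Env m n d k K dir s₂ := by
      rw [hs₂, hs₁]
      exact ⟨hr0, hr1, hr2, by simp [State.setReg], by simp [State.setReg], hT⟩
    have hval : s₂.valArr = s.valArr := by rw [hs₂, hs₁]; rfl
    refine (Runs.seq (runs_forward henv hm hn hkd hkK hKd hdir hinj (fun i hi => (hpos i hi).1)
      (fun i hi => (hpos i hi).2) hF (fun j hj c => ?_) fun r c hr => ?_)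
      (B' := 900 * (d * m * n) - 20) fun s₃ hs₃ => ?_).mono ?_ fun s' hs => hs
    · rw [hval, hL j (by omega)]
    · rw [hval, h0 r c hr]
    · obtain ⟨⟨hk₃, hI₃⟩, hW₃, hother⟩ := hs₃
      have henv₃ := henv.of_keeps hk₃ le_rfl hI₃
      refine (Runs.seq (runs_innermost henv₃ hkd hkK' hm hn hdir (hpos k le_rfl).1.le
        (hpos k le_rfl).2.le (fun h => ?_) hF (fun h => hW₃ k le_rfl h) ?_)
        (B' := 320 * (m * n) * k + 10) fun s₄ hs₄ => ?_).mono ?_ fun s' hs => hs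
      · by_contra! h'
        exact hpk ⟨h, h'.1, h'.2⟩
      · rw [hother 1 (by omega), hval, h1]
      · obtain ⟨⟨hk₄, hI₄⟩, hW₄, G, hG, hst⟩ := hs₄
        refine (runs_backward (henv₃.of_keeps hk₄ le_rfl hI₄) hkd hm hn hdir
          (fun i hi => (hpos i hi).1) (fun i hi => (hpos i hi).2) hF (fun i hi c => ?_) hG
          hst).mono le_rfl ?_
        · rw [hW₄, hW₃ i hi.le (by omega)]
        · rintro s' ⟨G', hG', hst'⟩
          refine ⟨G', by simpa [width, height] using hG'.support_subset,
            fun j hj c => hG'.planeSum_eq j (Nat.zero_le j) hj c, fun x hx => ?_⟩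
          rw [mem_box] at hx
          simpa using hst'.eq x.1 x.2 (by omega) (by omega)
      · have : 320 * (m * n) * k ≤ 320 * (d * m * n) := by
          calc 320 * (m * n) * k ≤ 320 * (m * n) * d := Nat.mul_le_mul_left _ hkd
            _ = 320 * (d * m * n) := by ring
        omega
    · have := forward_cost_le hm hn hdir hkd hKd hKk hfit (hpos k le_rfl).1 (hpos k le_rfl).2
      omega
  · rw [hcost]
    omega

theorem runs_reconstruct {m n d : ℕ} {dir : ℕ → ℤ × ℤ} {s : State V} (hr0 : s.reg 0 = m)
    (hr1 : s.reg 1 = n) (hr2 : s.reg 2 = d) (hi0 : ∀ h : ℕ, s.intArr 0 (h, 0) = (dir h).1)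
    (hi1 : ∀ h : ℕ, s.intArr 0 (h, 1) = (dir h).2) (hm : 0 < m)
    (hn : 0 < n) (hd : 0 < d) (hdir : ∀ j < d, IsDirection (dir j))
    (hinj : ∀ i < d, ∀ j < d, i ≠ j → dir i ≠ dir j) {f : ℤ × ℤ → V} (hf : f.support ⊆ box m n)
    (hL : ∀ j < d, ∀ c : ℤ, s.valArr 0 (j, c) = planeSum (dir j) f c)
    (h0 : ∀ r c : ℤ, d ≤ r → s.valArr 0 (r, c) = 0) (h1 : s.valArr 1 = 0) :
    Runs reconstruct s (5000 * (d * m * n)) fun s' => ∃ G : ℤ × ℤ → V, G.support ⊆ box m n ∧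
      (∀ j < d, ∀ c, planeSum (dir j) G c = planeSum (dir j) f c) ∧
      ∀ x ∈ box m n, s'.valArr 1 x = G x := by
  let p : ℕ → Prop := fun i => i < d ∧ (dir i).1 < m ∧ |(dir i).2| < n
  have hex : ∃ k, ¬ p k := ⟨d, fun h => lt_irrefl _ h.1⟩
  obtain ⟨h, hph, hh⟩ : ∃ k, ¬ p k ∧ ∀ i < k, p i := by
    classical
    exact ⟨Nat.find hex, Nat.find_spec hex, fun i hi => not_not.mp (Nat.find_min hex hi)⟩
  have hhd : h ≤ d := by
    by_contra h'
    exact lt_irrefl _ (hh d (by omega)).1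
  have hmn : 0 < d * m * n := Nat.mul_pos (Nat.mul_pos hd hm) hn
  have hmn' : m * n ≤ d * m * n := by
    rw [mul_assoc]
    exact Nat.le_mul_of_pos_left _ hd
  have hdm : d ≤ d * m * n := by
    rw [mul_assoc]
    exact Nat.le_mul_of_pos_right _ (Nat.mul_pos hm hn)
  have hcost : (fitsC 3 (.reg 0) (.reg 1)).cost = 27 := rfl
  refine (Runs.seq (runs_tabulate hr0 hr1 hr2 hi0 hi1) (B' := 4800 * (d * m * n))
    fun s₁ hs₁ => ?_).mono (by omega) fun s' hs => hs
  obtain ⟨hk₁, hT, hV₁⟩ := hs₁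
  have e0 : s₁.reg 0 = m := (hk₁ 0 (by omega)).trans hr0
  have e1 : s₁.reg 1 = n := (hk₁ 1 (by omega)).trans hr1
  have e2 : s₁.reg 2 = d := (hk₁ 2 (by omega)).trans hr2
  refine (Runs.seq (runs_search (k := h) (p := p) (fun j => ?_) hh hph)
    (B' := 4000 * (d * m * n) + 10) fun s₂ hs₂ => ?_).mono (by rw [hcost]; omega) fun s' hs => hs
  · exact holds_fitsC e2 (by simp [State.setReg]) (hT.fst j) (hT.snd j) (fun _ => e0) fun _ => e1
  · have f0 : s₂.reg 0 = m := by rw [hs₂]; exact e0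
    have f1 : s₂.reg 1 = n := by rw [hs₂]; exact e1
    have f2 : s₂.reg 2 = d := by rw [hs₂]; exact e2
    have f3 : s₂.reg 3 = h := by rw [hs₂]; simp [State.setReg]
    have fI : s₂.intArr = s₁.intArr := by rw [hs₂]; rfl
    have fV : s₂.valArr = s.valArr := by rw [hs₂, ← hV₁]; rfl
    have hc : (Cond.lt (.reg 3) (.reg 2)).Holds s₂ ↔ h < d := by
      rw [Cond.holds_lt, IntExpr.eval, IntExpr.eval, f2, f3, Nat.cast_lt]
    refine (Runs.ite (B := 4000 * (d * m * n)) (fun h' => ?_) fun h' => ?_).mono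
      (by simp only [Cond.lt, Cond.cost, IntExpr.cost]; omega) fun s' hs => hs
    · rw [hc] at h'
      refine (runs_readOff f0 f1 hm hn f3 (v := dir h) (by rw [fI]; exact hT.fst h)
        (by rw [fI]; exact hT.snd h) (hdir h h') ?_ hf fun c => ?_).mono (by omega)
        fun s' hs => ⟨f, hf, fun _ _ _ => rfl, hs⟩
      · by_contra! h''
        exact hph ⟨h', h''⟩
      · rw [fV, hL h h']
    · rw [hc] at h'
      have hhd' : h = d := by omega
      subst hhd'
      exact runs_interpolate f0 f1 f2 (fI ▸ hT) hm hn hd hdir hinj (fun j hj => (hh j hj).2) hf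
        (fun j hj c => by rw [fV, hL j hj]) (fun r c hr => by rw [fV, h0 r c hr])
        (by rw [fV, h1])

/-- Extension by zero to the plane. -/
noncomputable def extend {m n : ℕ} (f : grid m n → V) (x : ℤ × ℤ) : V :=
  if h : x ∈ grid m n then f ⟨x, h⟩ else 0

theorem mem_grid {m n : ℕ} {x : ℤ × ℤ} : x ∈ grid m n ↔ x ∈ box m n := by
  simp [grid, mem_box]

theorem lineSum_eq_planeSum {m n : ℕ} (v : ℤ × ℤ) (c : ℤ) {g : grid m n → V} {G : ℤ × ℤ → V}
    (hG : G.support ⊆ box m n) (hg : ∀ x, g x = G x.1) : lineSum v c g = planeSum v G c := by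
  rw [lineSum, planeSum, finsum_eq_sum_of_support_subset (s := grid m n),
    ← Finset.sum_coe_sort (grid m n)]
  · refine Finset.sum_congr rfl fun x _ => ?_
    rw [hg]
    refine if_congr ?_ rfl rfl
    rw [lineIndex]
    constructor <;> intro h <;> linarith
  · intro x hx
    exact mem_grid.mpr (hG fun h => hx (by simp [h]))

theorem lineSum_sub {m n : ℕ} (v : ℤ × ℤ) (c : ℤ) (f g : grid m n → V) :
    lineSum v c (fun x => f x - g x) = lineSum v c f - lineSum v c g := by
  simp only [lineSum, ← Finset.sum_sub_distrib]
  exact Finset.sum_congr rfl fun x _ => by split_ifs <;> simp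

end

end Tomography

theorem theorem5p1 :
    ∃ (P : Tomography.Program) (C : ℕ),
      ∀ (V : Type*) [AddCommGroup V] (m n : ℕ) (D : Finset (ℤ × ℤ)),
        0 < m → 0 < n → D.Nonempty → (∀ v ∈ D, Tomography.IsDirection v) →
        -- the directions are fed to the program in an arbitrary order
        ∀ (e : Fin D.card ≃ D) (f : Tomography.grid m n → V),
          ∃ (s : Tomography.State V) (k : ℕ),
            Tomography.Exec P
              (Tomography.inputState m n D.card (fun h => (e h : ℤ × ℤ))
                (fun h c => Tomography.lineSum (e h : ℤ × ℤ) c f)) s k ∧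
            k ≤ C * (D.card * m * n) ∧
            (∀ v ∈ D, ∀ c : ℤ,
              Tomography.lineSum v c (Tomography.output m n s) = Tomography.lineSum v c f) ∧
            ∀ x : Tomography.grid m n,
              (∀ S : Set (Tomography.grid m n),
                Tomography.IsSwitchingDomain V D S → x ∉ S) →
              Tomography.output m n s x = f x := by
  refine ⟨Tomography.reconstruct, 5000, fun V _ m n D hm hn hD hdir e f => ?_⟩
  let dir : ℕ → ℤ × ℤ := fun h => if hh : h < D.card then (e ⟨h, hh⟩ : ℤ × ℤ) else 0
  have hdir_eq : ∀ h (hh : h < D.card), dir h = e ⟨h, hh⟩ := fun h hh => dif_pos hh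
  have hfs : (Tomography.extend f).support ⊆ Tomography.box m n := fun x hx => by
    by_contra h
    exact hx (dif_neg fun h' => h (Tomography.mem_grid.mp h'))
  have hfl : ∀ v c, Tomography.lineSum v c f =
      Tomography.planeSum v (Tomography.extend f) c := fun v c =>
    Tomography.lineSum_eq_planeSum v c hfs fun x => by
      rw [Tomography.extend, dif_pos x.2]
  obtain ⟨s, k, hex, hk, G, hG, hGf, hout⟩ := Tomography.runs_reconstruct (m := m) (n := n)
    (d := D.card) (dir := dir) (f := Tomography.extend f)
    (s := Tomography.inputState m n D.card (fun h => (e h : ℤ × ℤ))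
      (fun h c => Tomography.lineSum (e h : ℤ × ℤ) c f))
    rfl rfl rfl (fun h => by
      by_cases hh : h < D.card <;> simp [Tomography.inputState, hh, dir]) (fun h => by
      by_cases hh : h < D.card <;> simp [Tomography.inputState, hh, dir]) hm hn
    (Finset.card_pos.mpr hD) (fun j hj => by
      rw [hdir_eq j hj]
      exact hdir _ (e ⟨j, hj⟩).2) (fun i hi j hj hij h => by
      rw [hdir_eq i hi, hdir_eq j hj] at h
      exact hij (by simpa using e.injective (Subtype.ext h))) hfs
    (fun j hj c => by
      rw [hdir_eq j hj, ← hfl]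
      simp [Tomography.inputState, hj]) (fun r c hr => by
      have : ¬ (0 ≤ r ∧ r.toNat < D.card) := by omega
      simp [Tomography.inputState, this]) (by
      funext c
      simp [Tomography.inputState])
  have hsums : ∀ v ∈ D, ∀ c : ℤ,
      Tomography.lineSum v c (Tomography.output m n s) = Tomography.lineSum v c f := by
    intro v hv c
    rw [Tomography.lineSum_eq_planeSum (g := Tomography.output m n s) v c hG fun x => hout x.1 (Tomography.mem_grid.mp x.2), hfl]
    have := hGf (e.symm ⟨v, hv⟩) (e.symm ⟨v, hv⟩).2 c
    rw [hdir_eq _ (e.symm ⟨v, hv⟩).2] at this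
    simpa using this
  refine ⟨s, k, hex, hk, hsums, fun x hx => ?_⟩
  -- The difference of the output and `f` is a switching function, so `x` is outside its support.
  by_contra hne
  refine hx _ ⟨fun y => Tomography.output m n s y - f y, fun v hv c => ?_, rfl⟩ (sub_ne_zero.mpr hne)
  rw [Tomography.lineSum_sub, hsums v hv c, sub_self]
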